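/- Let $m,n\ge 1$. Balls are Euclidean balls $B=B(x_B,r_B)\subset\mathbb{R}^n$ with $r_B>0$, and $\lambda B=B(x_B,\lambda r_B)$. For real exponents $\vec q=(q_1,\dots,q_m)$ with $1\le q_j<\infty$, let $\frac1q=\frac1{q_1}+\dots+\frac1{q_m}$, and for nonnegative measurable functions $\vec w=(w_1,\dots,w_m)$ on $\mathbb{R}^n$ write $\vec w\in A^\infty_{\vec q}$ if there are $\theta\ge 0$ and $C_0<\infty$ such that, for all balls $B$, $$\Big(\frac1{|B|}\int_B\prod_{j=1}^m w_j^{q/q_j}\,dx\Big)^{1/q}\prod_{j=1}^m\Big(\frac1{|B|}\int_B w_j^{1-q_j'}\,dx\Big)^{1/q_j'}\le C_0(1+r_B)^\theta ,$$ where $\frac1{q_j}+\frac1{q_j'}=1$ and, when $q_j=1$, the $j$-th factor of the product is understood as $(\operatorname{ess\,inf}_{B}w_j)^{-1}$. Let $(x_k)_{k\ge1}$ be a sequence of points such that the balls $Q_k=B(x_k,1)$ cover $\mathbb{R}^n$ and, for some constant $C_1$, $\sum_k\chi_{\sigma Q_k}\le C_1\sigma^n$ for all $\sigma>1$. For $s>0$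 and measurable $\vec f=(f_1,\dots,f_m)$ put $$\mathcal M_s(\vec f)(x)=\sup_{Q\ni x}\prod_{j=1}^m\Big(\frac1{|Q|}\int_Q|f_j(z)|^s\,dz\Big)^{1/s},\qquad \mathcal M_{\mathrm{loc},s}(\vec f)=\sum_k\chi_{Q_k}\,\mathcal M_s(f_1\chi_{8Q_k},\dots,f_m\chi_{8Q_k}),$$ the supremum being over all balls $Q$ containing $x$. Let $0<p_1,\dots,p_m<\infty$, $\frac1p=\frac1{p_1}+\dots+\frac1{p_m}$ and $\nu_{\vec w}=\prod_{j=1}^m w_j^{p/p_j}$. (i) If $p_1,\dots,p_m>s>0$ and $\vec w\in A^\infty_{\vec p/s}$, where $\vec p/s=(p_1/s,\dots,p_m/s)$, then there is a constant $C$ independent of $\vec f$ such that $$\|\mathcal M_{\mathrm{loc},s}(\vec f)\|_{L^p(\nu_{\vec w})}\le C\prod_{j=1}^m\|f_j\|_{L^{p_j}(w_j)} .$$ (ii) If $p_1,\dots,p_m\ge s>0$ and $\vec w\in A^\infty_{\vec p/s}$, then there is a constant $C$ independent of $\vec f$ such that $$\|\mathcal M_{\mathrm{loc},s}(\vec f)\|_{L^{p,\infty}(\nu_{\vec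 w})}\le C\prod_{j=1}^m\|f_j\|_{L^{p_j}(w_j)} ,$$ where $\|F\|_{L^{p,\infty}(\nu)}=\sup_{t>0}t\,\nu(\{|F|>t\})^{1/p}$. -/

import Mathlib

open MeasureTheory Metric Set
open scoped ENNReal NNReal

/-- The exponent `p` attached to `p₁, …, p_m` by `1/p = 1/p₁ + ⋯ + 1/p_m`. -/
noncomputable def harmonicExponent {m : ℕ} (p : Fin m → ℝ) : ℝ :=
  (∑ j, (p j)⁻¹)⁻¹

/-- The weight `ν_w = ∏ⱼ wⱼ ^ (p / pⱼ)`, as an extended nonnegative function. -/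
noncomputable def productWeight {m n : ℕ} (p : Fin m → ℝ)
    (w : Fin m → EuclideanSpace ℝ (Fin n) → ℝ≥0) (x : EuclideanSpace ℝ (Fin n)) : ℝ≥0∞ :=
  ∏ j, (w j x : ℝ≥0∞) ^ (harmonicExponent p / p j)

/-- The factor `(⨍_B v ^ (1 - q')) ^ (1 / q')` for the ball `B = B(c, r)`, where `q'` is the
exponent conjugate to `q`; for `q = 1` it is understood as `(ess inf_B v)⁻¹`.
Here `0 ^ (1 - q') = ∞`. -/
noncomputable def dualFactor {n : ℕ} (q : ℝ) (v : EuclideanSpace ℝ (Fin n) → ℝ≥0)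
    (c : EuclideanSpace ℝ (Fin n)) (r : ℝ) : ℝ≥0∞ :=
  if q = 1 then (essInf (fun x => (v x : ℝ≥0∞)) (volume.restrict (ball c r)))⁻¹
  else (⨍⁻ x in ball c r, (v x : ℝ≥0∞) ^ (1 - q.conjExponent) ∂volume) ^ (1 / q.conjExponent)

/-- The class `A_p^θ` of multiple weights. -/
def IsMultipleWeight {m n : ℕ} (p : Fin m → ℝ) (θ : ℝ)
    (w : Fin m → EuclideanSpace ℝ (Fin n) → ℝ≥0) : Prop :=
  (∀ j, AEMeasurable (w j) volume) ∧
  ∃ C : ℝ≥0, ∀ (c : EuclideanSpace ℝ (Fin n)) (r : ℝ), 0 < r →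
    (⨍⁻ x in ball c r, productWeight p w x ∂volume) ^ (1 / harmonicExponent p) *
        ∏ j, dualFactor (p j) (w j) c r
      ≤ C * ENNReal.ofReal ((1 + r) ^ θ)

/-- The class `A_p^∞`, the union of the classes `A_p^θ` over `θ ≥ 0`. -/
def IsMultipleWeightInfty {m n : ℕ} (p : Fin m → ℝ)
    (w : Fin m → EuclideanSpace ℝ (Fin n) → ℝ≥0) : Prop :=
  ∃ θ : ℝ, 0 ≤ θ ∧ IsMultipleWeight p θ w

/-- The balls `B(xₖ, 1)` cover the space, and for some constant `C` and every `σ > 1` at most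
`C σ ^ n` of the balls `B(xₖ, σ)` meet at any point. -/
def IsCriticalCovering {n : ℕ} (x : ℕ → EuclideanSpace ℝ (Fin n)) : Prop :=
  (⋃ k, ball (x k) 1) = univ ∧
  ∃ C : ℝ≥0, ∀ σ : ℝ, 1 < σ → ∀ y : EuclideanSpace ℝ (Fin n),
    ∑' k, (ball (x k) σ).indicator (fun _ => (1 : ℝ≥0∞)) y ≤ C * ENNReal.ofReal (σ ^ n)

/-- The multilinear maximal function
`M_s(f)(x) = sup_{Q ∋ x} ∏ⱼ (⨍_Q |fⱼ| ^ s) ^ (1 / s)`, the supremum being over all balls. -/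
noncomputable def multilinearMaximal {m n : ℕ} (s : ℝ)
    (f : Fin m → EuclideanSpace ℝ (Fin n) → ℂ) (x : EuclideanSpace ℝ (Fin n)) : ℝ≥0∞ :=
  ⨆ (c : EuclideanSpace ℝ (Fin n)) (r : ℝ) (_ : 0 < r) (_ : x ∈ ball c r),
    ∏ j, (⨍⁻ z in ball c r, ‖f j z‖ₑ ^ s ∂volume) ^ (1 / s)

/-- The localized maximal function `∑ₖ χ_{Qₖ} M_s(f χ_{8 Qₖ})`, where `Qₖ = B(xₖ, 1)`. -/
noncomputable def localizedMaximal {m n : ℕ} (s : ℝ) (x : ℕ → EuclideanSpace ℝ (Fin n))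
    (f : Fin m → EuclideanSpace ℝ (Fin n) → ℂ) (y : EuclideanSpace ℝ (Fin n)) : ℝ≥0∞ :=
  ∑' k, (ball (x k) 1).indicator
    (multilinearMaximal s (fun j => (ball (x k) 8).indicator (f j))) y

/-- The quasinorm of the weak Lebesgue space `L^{p,∞}(μ)`:
`sup_{t > 0} t · μ {F > t} ^ (1 / p)`. -/
noncomputable def weakLpNorm {α : Type*} [MeasurableSpace α] (F : α → ℝ≥0∞) (p : ℝ)
    (μ : Measure α) : ℝ≥0∞ :=
  ⨆ t : ℝ≥0, (t : ℝ≥0∞) * μ {x | (t : ℝ≥0∞) < F x} ^ (1 / p)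

/-! Only bounded radii matter. On `Qₖ` the functions are cut off to `8 Qₖ`, so a ball of radius at
least 8 gives no more than `8 Qₖ` itself. With the bounded overlap of the `Qₖ`, `localizedMaximal`
is at most a constant times the power `1/s` of `averageMaximal 8` applied to the functions
`|f_j|^s`. For radii at most `R` the factor `(1+r)^θ` is bounded, so with `q_j = p_j/s` the
hypothesis becomes a classical A_q condition on small balls, which already makes `ν = ν_w` doubling
on small balls.

Weak type. Hölder on one ball gives `ν(B)^(1/q) ∏ ⨍_B F_j ≤ K ∏ (∫_B F_j^{q_j} w_j)^(1/q_j)`. A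
Vitali selection makes the balls disjoint, and discrete Hölder with the exponents `q/q_j`, of sum 1,
adds up the estimates.

Strong type. No self-improvement of the weight class is needed. The weights `ν` and `σ_j =
w_j^(1-q_j')` satisfy `ν^(1/q) ∏ σ_j^(1/q_j') = 1` pointwise, while the same product of their
averages over a small ball is at most `K`. Hence on at least half of the ball every weight is
bounded below by a fixed multiple of its average (`BalancedWeights.exists_large_subset`). There `⨍_B
F_j` is at most a constant times `σ_j M_{σ_j}(F_j/σ_j)`, where `M_μ` is the maximal function of the
measure `μ`. Averaging in `ν` over this half bounds the power `d` of the multilinear maximal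
function by `M_ν(H^d)`, with `H = ∏ σ_j M_{σ_j}(F_j/σ_j)`. Taking `d = q/2`, the `L²(ν)` bound for
`M_ν`, Hölder, and the `L^{q_j}(σ_j)` bounds for `M_{σ_j}` finish the proof. These linear bounds
need only local doubling. -/

/-! ### Maximal functions of locally doubling measures -/

section LocalMaximal

variable {E : Type*} [PseudoMetricSpace E]

/-- The supremum of a ball functional `Φ` over the balls of radius at most `R` through `x`. -/
noncomputable def ballSup (R : ℝ) (Φ : E → ℝ → ℝ≥0∞) (x : E) : ℝ≥0∞ :=
  ⨆ (c : E) (r : ℝ) (_ : 0 < r) (_ : r ≤ R) (_ : x ∈ ball c r), Φ c r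

theorem le_ballSup {R : ℝ} {Φ : E → ℝ → ℝ≥0∞} {x c : E} {r : ℝ} (h0 : 0 < r) (hR : r ≤ R)
    (hx : x ∈ ball c r) : Φ c r ≤ ballSup R Φ x :=
  le_iSup_of_le c <| le_iSup_of_le r <| le_iSup_of_le h0 <| le_iSup_of_le hR <|
    le_iSup_of_le hx le_rfl

theorem ballSup_le {R : ℝ} {Φ : E → ℝ → ℝ≥0∞} {x : E} {b : ℝ≥0∞}
    (h : ∀ c r, 0 < r → r ≤ R → x ∈ ball c r → Φ c r ≤ b) : ballSup R Φ x ≤ b :=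
  iSup_le fun c => iSup_le fun r => iSup_le fun h0 => iSup_le fun hR => iSup_le fun hx =>
    h c r h0 hR hx

theorem lt_ballSup_iff {R : ℝ} {Φ : E → ℝ → ℝ≥0∞} {x : E} {b : ℝ≥0∞} :
    b < ballSup R Φ x ↔ ∃ c r, 0 < r ∧ r ≤ R ∧ x ∈ ball c r ∧ b < Φ c r := by
  simp only [ballSup, lt_iSup_iff, exists_prop]

/-- A ball that witnesses the inequality at one point witnesses it at all of its points. Nothing is
asked of `Φ`, so every maximal function below is measurable. -/
theorem isOpen_lt_ballSup (R : ℝ) (Φ : E → ℝ → ℝ≥0∞) (b : ℝ≥0∞) :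
    IsOpen {x | b < ballSup R Φ x} := by
  rw [isOpen_iff_mem_nhds]
  intro x hx
  obtain ⟨c, r, h0, hR, hxc, hb⟩ := lt_ballSup_iff.1 hx
  filter_upwards [isOpen_ball.mem_nhds hxc] with y hy
  exact lt_ballSup_iff.2 ⟨c, r, h0, hR, hy, hb⟩

theorem measurable_ballSup [MeasurableSpace E] [OpensMeasurableSpace E] (R : ℝ)
    (Φ : E → ℝ → ℝ≥0∞) : Measurable (ballSup R Φ) :=
  measurable_of_Ioi fun b => (isOpen_lt_ballSup R Φ b).measurableSet

/-- A form of doubling for the balls of radius at most `R`. -/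
def LocallyDoubling [MeasurableSpace E] (μ : Measure E) (R : ℝ) (D : ℝ≥0∞) : Prop :=
  ∀ c r, 0 < r → r ≤ R → μ (ball c (6 * r)) ≤ D * μ (ball c r)

/-- The maximal function with respect to `μ` over balls of radius at most `R`. -/
noncomputable def measureMaximal [MeasurableSpace E] (μ : Measure E) (R : ℝ) (g : E → ℝ≥0∞) :
    E → ℝ≥0∞ :=
  ballSup R fun c r => (μ (ball c r))⁻¹ * ∫⁻ y in ball c r, g y ∂μ

theorem measurable_measureMaximal [MeasurableSpace E] [OpensMeasurableSpace E] (μ : Measure E)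
    (R : ℝ) (g : E → ℝ≥0∞) : Measurable (measureMaximal μ R g) :=
  measurable_ballSup _ _

/-- Vitali covering of a superlevel set of `ballSup`. -/
theorem exists_disjoint_balls_of_lt_ballSup [SecondCountableTopology E] [MeasurableSpace E]
    {μ : Measure E} {R : ℝ} {D : ℝ≥0∞} (hD : LocallyDoubling μ R D) (Φ : E → ℝ → ℝ≥0∞)
    (b : ℝ≥0∞) :
    ∃ u : Set (E × ℝ), u.Countable ∧ (∀ a ∈ u, 0 < a.2 ∧ a.2 ≤ R ∧ b < Φ a.1 a.2) ∧
      (u.PairwiseDisjoint fun a => ball a.1 a.2) ∧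
      μ {x | b < ballSup R Φ x} ≤ D * ∑' a : u, μ (ball a.1.1 a.1.2) := by
  -- Vitali enlarges closed balls by 5; the factor 6 in `LocallyDoubling` leaves room to return to
  -- open balls.
  obtain ⟨u, hut, hdisj, hcov⟩ := Vitali.exists_disjoint_subfamily_covering_enlargement_closedBall
    {a : E × ℝ | 0 < a.2 ∧ a.2 ≤ R ∧ b < Φ a.1 a.2} Prod.fst Prod.snd R (fun a ha => ha.2.1)
    5 (by norm_num)
  have hdisj' : u.PairwiseDisjoint fun a => ball a.1 a.2 :=
    hdisj.mono fun a => ball_subset_closedBall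
  have hc : u.Countable := hdisj'.countable_of_isOpen (fun a _ => isOpen_ball)
    fun a ha => nonempty_ball.2 (hut ha).1
  refine ⟨u, hc, fun a ha => hut ha, hdisj', ?_⟩
  have := hc.to_subtype
  calc μ {x | b < ballSup R Φ x} ≤ μ (⋃ a : u, ball a.1.1 (6 * a.1.2)) := by
        refine measure_mono fun x hx => ?_
        obtain ⟨c, r, h0, hR, hxc, hb⟩ := lt_ballSup_iff.1 hx
        obtain ⟨a, ha, hsub⟩ := hcov (c, r) ⟨h0, hR, hb⟩
        have h1 := hsub (ball_subset_closedBall hxc)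
        refine mem_iUnion.2 ⟨⟨a, ha⟩, closedBall_subset_ball ?_ h1⟩
        have := (hut ha).1
        linarith
    _ ≤ ∑' a : u, μ (ball a.1.1 (6 * a.1.2)) := measure_iUnion_le _
    _ ≤ ∑' a : u, D * μ (ball a.1.1 a.1.2) :=
        ENNReal.tsum_le_tsum fun a => hD _ _ (hut a.2).1 (hut a.2).2.1
    _ = _ := ENNReal.tsum_mul_left

theorem tsum_setLIntegral_le_of_pairwiseDisjoint [MeasurableSpace E] [OpensMeasurableSpace E]
    {μ : Measure E} {u : Set (E × ℝ)} (hc : u.Countable)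
    (hd : u.PairwiseDisjoint fun a => ball a.1 a.2) (g : E → ℝ≥0∞) :
    ∑' a : u, ∫⁻ y in ball a.1.1 a.1.2, g y ∂μ ≤ ∫⁻ y, g y ∂μ := by
  have := hc.to_subtype
  rw [← lintegral_iUnion (s := fun a : u => ball a.1.1 a.1.2) (fun a => isOpen_ball.measurableSet)
    (fun a b hab => hd a.2 b.2 (fun h => hab (Subtype.ext h)))]
  exact setLIntegral_le_lintegral _ _

theorem mul_measure_lt_measureMaximal_le [SecondCountableTopology E] [MeasurableSpace E]
    [OpensMeasurableSpace E] {μ : Measure E} {R : ℝ} {D : ℝ≥0∞} (hD : LocallyDoubling μ R D)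
    (g : E → ℝ≥0∞) (b : ℝ≥0∞) :
    b * μ {x | b < measureMaximal μ R g x} ≤ D * ∫⁻ y, g y ∂μ := by
  obtain ⟨u, hc, hu, hd, hle⟩ := exists_disjoint_balls_of_lt_ballSup hD
    (fun c r => (μ (ball c r))⁻¹ * ∫⁻ y in ball c r, g y ∂μ) b
  calc b * μ {x | b < measureMaximal μ R g x} ≤ b * (D * ∑' a : u, μ (ball a.1.1 a.1.2)) := by
        gcongr; exact hle
    _ = D * ∑' a : u, b * μ (ball a.1.1 a.1.2) := by rw [ENNReal.tsum_mul_left]; ring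
    _ ≤ D * ∑' a : u, ∫⁻ y in ball a.1.1 a.1.2, g y ∂μ := by
        gcongr with a
        have h := (hu a.1 a.2).2.2
        rw [mul_comm, ← div_eq_mul_inv] at h
        exact ENNReal.mul_le_of_le_div h.le
    _ ≤ _ := by
        gcongr
        exact tsum_setLIntegral_le_of_pairwiseDisjoint hc hd g

/-- The part of `g` below height `b` contributes at most `b` to any average. This is the truncation
in Marcinkiewicz interpolation between the weak (1,1) bound and the sup bound. -/
theorem measureMaximal_le_add [MeasurableSpace E] [OpensMeasurableSpace E] (μ : Measure E) (R : ℝ)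
    (g : E → ℝ≥0∞) (b : ℝ≥0∞) (x : E) :
    measureMaximal μ R g x ≤ measureMaximal μ R ({y | b < g y}.indicator g) x + b := by
  refine ballSup_le fun c r h0 hR hx => ?_
  calc (μ (ball c r))⁻¹ * ∫⁻ y in ball c r, g y ∂μ
      ≤ (μ (ball c r))⁻¹ * ∫⁻ y in ball c r, ({y | b < g y}.indicator g y + b) ∂μ := by
        gcongr with y
        by_cases h : b < g y
        · rw [indicator_of_mem (show y ∈ {y | b < g y} from h)]; exact le_self_add
        · exact (not_lt.1 h).trans le_add_self
    _ = (μ (ball c r))⁻¹ * ∫⁻ y in ball c r, {y | b < g y}.indicator g y ∂μ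
          + (μ (ball c r))⁻¹ * (b * μ (ball c r)) := by
        rw [lintegral_add_right _ measurable_const, mul_add, setLIntegral_const]
    _ ≤ _ := by
        gcongr
        · exact le_ballSup (Φ := fun c r => (μ (ball c r))⁻¹ *
            ∫⁻ y in ball c r, {y | b < g y}.indicator g y ∂μ) h0 hR hx
        · rw [mul_left_comm]
          exact mul_le_of_le_one_right' (ENNReal.inv_mul_le_one _)

/-- Layer cake formula for a single number. -/
theorem ENNReal.lintegral_Ioi_indicator_rpow {q : ℝ} (hq : 0 < q) (a : ℝ≥0∞) :
    ENNReal.ofReal q * ∫⁻ t in Ioi (0 : ℝ),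
      {t : ℝ | ENNReal.ofReal t < a}.indicator (fun t => ENNReal.ofReal (t ^ (q - 1))) t = a ^ q := by
  have key : ∀ b : ℝ≥0, ENNReal.ofReal q * ∫⁻ t in Ioi (0 : ℝ),
      {t : ℝ | ENNReal.ofReal t < b}.indicator (fun t => ENNReal.ofReal (t ^ (q - 1))) t
        = (b : ℝ≥0∞) ^ q := by
    intro b
    have h := lintegral_rpow_eq_lintegral_meas_lt_mul (Measure.dirac ()) (f := fun _ => (b : ℝ))
      (Filter.Eventually.of_forall fun _ => b.2) aemeasurable_const hq
    rw [lintegral_const, measure_univ, mul_one,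
      ← ENNReal.ofReal_rpow_of_nonneg b.coe_nonneg hq.le, ENNReal.ofReal_coe_nnreal] at h
    rw [h]
    congr 1
    refine setLIntegral_congr_fun measurableSet_Ioi fun t ht => ?_
    by_cases hb : t < b
    · have : ENNReal.ofReal t < b := by
        rw [← ENNReal.ofReal_coe_nnreal]
        exact (ENNReal.ofReal_lt_ofReal_iff_of_nonneg (le_of_lt ht)).2 hb
      simp [this, hb]
    · have : ¬ ENNReal.ofReal t < b := by
        rw [← ENNReal.ofReal_coe_nnreal]
        exact fun h => hb ((ENNReal.ofReal_lt_ofReal_iff_of_nonneg (le_of_lt ht)).1 h)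
      simp [this, hb]
  induction a using ENNReal.recTopCoe with
  | coe b => exact key b
  | top =>
    rw [ENNReal.top_rpow_of_pos hq]
    -- The infinite value dominates the finite case at `b^(1/q)`, which equals `b`.
    refine ENNReal.eq_top_of_forall_nnreal_le fun b => ?_
    have hb := key (b ^ q⁻¹)
    rw [← ENNReal.coe_rpow_of_nonneg _ hq.le, ← NNReal.rpow_mul, inv_mul_cancel₀ hq.ne',
      NNReal.rpow_one] at hb
    rw [← hb]
    gcongr
    exact le_top

/-- The strong type inequality for the maximal function of a locally doubling measure. -/
theorem lintegral_measureMaximal_rpow_le [SecondCountableTopology E] [MeasurableSpace E]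
    [OpensMeasurableSpace E] {μ : Measure E} [SFinite μ] {R : ℝ} {D : ℝ≥0∞}
    (hD : LocallyDoubling μ R D) {q : ℝ} (hq : 1 < q) {g : E → ℝ≥0∞} (hg : Measurable g) :
    ∫⁻ x, measureMaximal μ R g x ^ q ∂μ ≤
      ENNReal.ofReal q * (ENNReal.ofReal (q - 1))⁻¹ * (2 ^ q * D) * ∫⁻ x, g x ^ q ∂μ := by
  have hq0 : 0 < q := by linarith
  have hM := measurable_measureMaximal μ R g
  have hmeas : ∀ {k : E → ℝ≥0∞} {ρ : ℝ}, Measurable k → Measurable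
      (fun z : E × ℝ => {t : ℝ | ENNReal.ofReal t < k z.1}.indicator
        (fun t => ENNReal.ofReal (t ^ ρ)) z.2) := by
    intro k ρ hk
    have hs : MeasurableSet {z : E × ℝ | ENNReal.ofReal z.2 < k z.1} :=
      measurableSet_lt (by fun_prop) (by fun_prop)
    have : Measurable fun z : E × ℝ => ENNReal.ofReal (z.2 ^ ρ) := by fun_prop
    exact this.indicator hs
  -- Weak (1,1) at height `t/2` for `g` truncated at `t/2`; the other half of `t` is absorbed by the
  -- low part of `g`.
  have step : ∀ t : ℝ, 0 < t →
      ∫⁻ x, {t : ℝ | ENNReal.ofReal t < measureMaximal μ R g x}.indicator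
        (fun t => ENNReal.ofReal (t ^ (q - 1))) t ∂μ ≤
      2 * D * ∫⁻ x, g x * {t : ℝ | ENNReal.ofReal t < 2 * g x}.indicator
        (fun t => ENNReal.ofReal (t ^ (q - 1 - 1))) t ∂μ := by
    intro t ht
    set b : ℝ≥0∞ := ENNReal.ofReal (t / 2) with hb
    have hbb : ENNReal.ofReal t = b + b := by
      rw [hb, ← ENNReal.ofReal_add (by positivity) (by positivity)]; congr 1; ring
    have hsub : {x | ENNReal.ofReal t < measureMaximal μ R g x} ⊆
        {x | b < measureMaximal μ R ({y | b < g y}.indicator g) x} := by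
      intro x hx
      have h1 := lt_of_lt_of_le hx (measureMaximal_le_add μ R g b x)
      rw [hbb] at h1
      exact lt_of_add_lt_add_right h1
    have hw := mul_measure_lt_measureMaximal_le hD ({y | b < g y}.indicator g) b
    have hset : MeasurableSet {y | b < g y} := measurableSet_lt measurable_const hg
    calc ∫⁻ x, {t : ℝ | ENNReal.ofReal t < measureMaximal μ R g x}.indicator
          (fun t => ENNReal.ofReal (t ^ (q - 1))) t ∂μ
        = ∫⁻ x, {x | ENNReal.ofReal t < measureMaximal μ R g x}.indicator
          (fun _ => ENNReal.ofReal (t ^ (q - 1))) x ∂μ := by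
          rfl
      _ = ENNReal.ofReal (t ^ (q - 1)) * μ {x | ENNReal.ofReal t < measureMaximal μ R g x} := by
          rw [lintegral_indicator_const (measurableSet_lt measurable_const hM)]
      _ ≤ ENNReal.ofReal (t ^ (q - 1)) *
            μ {x | b < measureMaximal μ R ({y | b < g y}.indicator g) x} := by gcongr
      _ = 2 * ENNReal.ofReal (t ^ (q - 1 - 1)) *
            (b * μ {x | b < measureMaximal μ R ({y | b < g y}.indicator g) x}) := by
          have : ENNReal.ofReal (t ^ (q - 1)) = 2 * ENNReal.ofReal (t ^ (q - 1 - 1)) * b := by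
            rw [show (2 : ℝ≥0∞) = ENNReal.ofReal 2 by simp, hb,
              ← ENNReal.ofReal_mul (by norm_num), ← ENNReal.ofReal_mul (by positivity)]
            congr 1
            rw [Real.rpow_sub_one ht.ne' (q - 1)]
            field_simp
          rw [this]; ring
      _ ≤ 2 * ENNReal.ofReal (t ^ (q - 1 - 1)) * (D * ∫⁻ y, {y | b < g y}.indicator g y ∂μ) := by
          gcongr
      _ = 2 * D * (ENNReal.ofReal (t ^ (q - 1 - 1)) * ∫⁻ y, {y | b < g y}.indicator g y ∂μ) := by
          ring
      _ = _ := by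
          rw [← lintegral_const_mul _ (hg.indicator hset)]
          congr 1
          refine lintegral_congr fun x => ?_
          have hiff : b < g x ↔ ENNReal.ofReal t < 2 * g x := by
            rw [hbb, ← two_mul, ENNReal.mul_lt_mul_iff_right (by simp) (by simp)]
          by_cases h : b < g x
          · rw [indicator_of_mem (show x ∈ {y | b < g y} from h),
              indicator_of_mem (show t ∈ {t : ℝ | ENNReal.ofReal t < 2 * g x} from hiff.1 h),
              mul_comm]
          · rw [indicator_of_notMem (show x ∉ {y | b < g y} from h),
              indicator_of_notMem (show t ∉ {t : ℝ | ENNReal.ofReal t < 2 * g x} from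
                fun h' => h (hiff.2 h')), mul_zero, mul_zero]
  have hq1 : ENNReal.ofReal (q - 1) ≠ 0 := by simpa using hq
  -- Layer cake and Tonelli reduce the claim to the integral of `t^(q-2)` over `0 < t < 2g`, which
  -- converges because `q > 1` and equals `(2g)^(q-1)/(q-1)`.
  calc ∫⁻ x, measureMaximal μ R g x ^ q ∂μ
      = ENNReal.ofReal q * ∫⁻ t in Ioi (0 : ℝ), ∫⁻ x,
          {t : ℝ | ENNReal.ofReal t < measureMaximal μ R g x}.indicator
            (fun t => ENNReal.ofReal (t ^ (q - 1))) t ∂μ := by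
        rw [lintegral_lintegral_swap, ← lintegral_const_mul']
        · exact lintegral_congr fun x => (ENNReal.lintegral_Ioi_indicator_rpow hq0 _).symm
        · simp
        · exact ((hmeas hM).comp measurable_swap).aemeasurable
    _ ≤ ENNReal.ofReal q * ∫⁻ t in Ioi (0 : ℝ), 2 * D * ∫⁻ x, g x *
          {t : ℝ | ENNReal.ofReal t < 2 * g x}.indicator
            (fun t => ENNReal.ofReal (t ^ (q - 1 - 1))) t ∂μ := by
        gcongr ENNReal.ofReal q * ?_
        exact setLIntegral_mono' measurableSet_Ioi step
    _ = ENNReal.ofReal q * (2 * D * ∫⁻ x, g x * (∫⁻ t in Ioi (0 : ℝ),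
          {t : ℝ | ENNReal.ofReal t < 2 * g x}.indicator
            (fun t => ENNReal.ofReal (t ^ (q - 1 - 1))) t) ∂μ) := by
        have h2 : Measurable fun z : ℝ × E => g z.2 *
            {t : ℝ | ENNReal.ofReal t < 2 * g z.2}.indicator
              (fun t => ENNReal.ofReal (t ^ (q - 1 - 1))) z.1 :=
          (hg.comp measurable_snd).mul
            ((hmeas (k := fun x => 2 * g x) (hg.const_mul 2)).comp measurable_swap)
        rw [lintegral_const_mul _ h2.lintegral_prod_right', lintegral_lintegral_swap h2.aemeasurable]
        congr 3 with x
        have h3 : Measurable fun t : ℝ => {t : ℝ | ENNReal.ofReal t < 2 * g x}.indicator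
            (fun t => ENNReal.ofReal (t ^ (q - 1 - 1))) t :=
          (hmeas (k := fun x => 2 * g x) (hg.const_mul 2)).comp measurable_prodMk_left
        exact lintegral_const_mul (g x) h3
    _ = ENNReal.ofReal q * (2 * D * ∫⁻ x, g x *
          ((ENNReal.ofReal (q - 1))⁻¹ * (2 * g x) ^ (q - 1)) ∂μ) := by
        congr 3 with x
        rw [← ENNReal.lintegral_Ioi_indicator_rpow (sub_pos.2 hq) (2 * g x), ← mul_assoc
          (ENNReal.ofReal (q - 1))⁻¹, ENNReal.inv_mul_cancel hq1 (by simp), one_mul]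
    _ = ENNReal.ofReal q * (2 * D * ∫⁻ x, (ENNReal.ofReal (q - 1))⁻¹ * 2 ^ (q - 1) *
          g x ^ q ∂μ) := by
        congr 3 with x
        rw [ENNReal.mul_rpow_of_nonneg _ _ (by linarith)]
        have : g x ^ q = g x * g x ^ (q - 1) := by
          conv_rhs => lhs; rw [← ENNReal.rpow_one (g x)]
          rw [← ENNReal.rpow_add_of_nonneg _ _ (by norm_num) (by linarith)]
          congr 1; ring
        rw [this]; ring
    _ = _ := by
        rw [lintegral_const_mul _ (hg.pow_const q)]
        have : (2 : ℝ≥0∞) ^ q = 2 * 2 ^ (q - 1) := by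
          conv_rhs => lhs; rw [← ENNReal.rpow_one 2]
          rw [← ENNReal.rpow_add_of_nonneg _ _ (by norm_num) (by linarith)]
          congr 1; ring
        rw [this]; ring

end LocalMaximal

/-- Hölder for the counting measure; it sums the one-ball estimates over a disjoint family. -/
theorem ENNReal.tsum_prod_rpow_le {α ι : Type*} [Countable α] (s : Finset ι) (f : ι → α → ℝ≥0∞)
    {p : ι → ℝ} (hp : ∑ i ∈ s, p i = 1) (h2p : ∀ i ∈ s, 0 ≤ p i) :
    ∑' a, ∏ i ∈ s, f i a ^ p i ≤ ∏ i ∈ s, (∑' a, f i a) ^ p i := by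
  let _ : MeasurableSpace α := ⊤
  simpa only [lintegral_count] using ENNReal.lintegral_prod_norm_pow_le (μ := Measure.count) s
    (f := f) (fun i _ => (measurable_from_top (f := f i)).aemeasurable) hp h2p

/-! ### Hölder's inequality, local doubling and the weak type bound -/

section HolderWeights

theorem ENNReal.prod_rpow_eq_rpow_sum {ι : Type*} (s : Finset ι) (a : ℝ≥0∞) {p : ι → ℝ}
    (hp : ∀ i ∈ s, 0 ≤ p i) : ∏ i ∈ s, a ^ p i = a ^ ∑ i ∈ s, p i := by
  classical
  induction s using Finset.induction with
  | empty => simp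
  | insert i s hi ih =>
    rw [Finset.prod_insert hi, Finset.sum_insert hi, ih fun k hk => hp k (Finset.mem_insert_of_mem hk),
      ← ENNReal.rpow_add_of_nonneg _ _ (hp i (Finset.mem_insert_self i s))
        (Finset.sum_nonneg fun k hk => hp k (Finset.mem_insert_of_mem hk))]

/-- Hölder's inequality for functions whose weighted geometric mean is `1`. -/
theorem measure_univ_pow_le_prod_lintegral_rpow {α ι : Type*} [MeasurableSpace α] {μ : Measure α}
    [Fintype ι] {m : ℕ} (hm : m ≠ 0) {g : ι → α → ℝ≥0∞} (hg : ∀ i, Measurable (g i))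
    {a : ι → ℝ} (ha : ∀ i, 0 ≤ a i) (hsum : ∑ i, a i = m) (h1 : ∀ x, ∏ i, g i x ^ a i = 1) :
    μ univ ^ m ≤ ∏ i, (∫⁻ x, g i x ∂μ) ^ a i := by
  have hm' : (m : ℝ) ≠ 0 := by exact_mod_cast hm
  have h := ENNReal.lintegral_prod_norm_pow_le (μ := μ) Finset.univ
    (fun i _ => (hg i).aemeasurable) (p := fun i => a i / m)
    (by rw [← Finset.sum_div, hsum, div_self hm']) (fun i _ => div_nonneg (ha i) (by positivity))
  -- Hölder needs exponents of sum 1, hence `a i / m`; the `m`-th power is taken afterwards.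
  have h2 : ∀ b : ι → ℝ≥0∞, ∏ i, b i ^ (a i / m) = (∏ i, b i ^ a i) ^ (1 / m : ℝ) := by
    intro b
    rw [← ENNReal.prod_rpow_of_nonneg (by positivity)]
    exact Finset.prod_congr rfl fun i _ => by rw [← ENNReal.rpow_mul]; congr 1; ring
  simp only [h2, h1, ENNReal.one_rpow, lintegral_const, one_mul] at h
  calc μ univ ^ m ≤ ((∏ i, (∫⁻ x, g i x ∂μ) ^ a i) ^ (1 / m : ℝ)) ^ m := by gcongr
    _ = _ := by
      rw [← ENNReal.rpow_natCast, ← ENNReal.rpow_mul, one_div, inv_mul_cancel₀ hm',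
        ENNReal.rpow_one]

variable {m n : ℕ}

theorem inv_harmonicExponent (q : Fin m → ℝ) : 1 / harmonicExponent q = ∑ j, (q j)⁻¹ := by
  simp [harmonicExponent]

theorem harmonicExponent_pos (hm : 1 ≤ m) {q : Fin m → ℝ} (hq : ∀ j, 0 < q j) :
    0 < harmonicExponent q := by
  have : Nonempty (Fin m) := ⟨⟨0, hm⟩⟩
  exact inv_pos.2 (Finset.sum_pos (fun j _ => inv_pos.2 (hq j)) Finset.univ_nonempty)

theorem sum_harmonicExponent_div (hm : 1 ≤ m) {q : Fin m → ℝ} (hq : ∀ j, 0 < q j) :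
    ∑ j, harmonicExponent q / q j = 1 := by
  simp_rw [div_eq_mul_inv]
  rw [← Finset.mul_sum, ← inv_harmonicExponent, mul_one_div,
    div_self (harmonicExponent_pos hm hq).ne']

theorem measurable_productWeight {q : Fin m → ℝ} {w : Fin m → EuclideanSpace ℝ (Fin n) → ℝ≥0}
    (hw : ∀ j, Measurable (w j)) : Measurable (productWeight q w) :=
  Finset.measurable_fun_prod _ fun j _ => (hw j).coe_nnreal_ennreal.pow_const _

theorem productWeight_ne_zero {q : Fin m → ℝ} {w : Fin m → EuclideanSpace ℝ (Fin n) → ℝ≥0}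
    {x : EuclideanSpace ℝ (Fin n)} (hw : ∀ j, w j x ≠ 0) : productWeight q w x ≠ 0 :=
  Finset.prod_ne_zero_iff.2 fun j _ => by simp [hw j]

theorem productWeight_ne_top {q : Fin m → ℝ} {w : Fin m → EuclideanSpace ℝ (Fin n) → ℝ≥0}
    {x : EuclideanSpace ℝ (Fin n)} (hw : ∀ j, w j x ≠ 0) : productWeight q w x ≠ ∞ :=
  ENNReal.prod_ne_top fun j _ => by simp [hw j]

/-- Hölder's inequality against the dual factor of a weight. -/
theorem setLAverage_le_mul_dualFactor {q : ℝ} (hq : 1 ≤ q) {v : EuclideanSpace ℝ (Fin n) → ℝ≥0}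
    (hv : Measurable v) (hv0 : ∀ x, v x ≠ 0) {F : EuclideanSpace ℝ (Fin n) → ℝ≥0∞}
    (hF : Measurable F) (c : EuclideanSpace ℝ (Fin n)) (r : ℝ) :
    ⨍⁻ x in ball c r, F x ∂volume ≤
      (⨍⁻ x in ball c r, F x ^ q * v x ∂volume) ^ (1 / q) * dualFactor q v c r := by
  have hv' : Measurable fun x => (v x : ℝ≥0∞) := hv.coe_nnreal_ennreal
  rcases hq.eq_or_lt with rfl | hq
  · simp only [dualFactor, if_true, ENNReal.rpow_one, div_one]
    simp only [laverage]
    rw [← lintegral_mul_const _ (by fun_prop)]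
    refine lintegral_mono_ae ?_
    refine Measure.ae_smul_measure ?_ _
    filter_upwards [ae_essInf_le (μ := volume.restrict (ball c r))
      (f := fun x => (v x : ℝ≥0∞))] with x hx
    have hvx : (v x : ℝ≥0∞) ≠ 0 := by simpa using hv0 x
    calc F x = F x * v x * (v x : ℝ≥0∞)⁻¹ := by
          rw [mul_assoc, ENNReal.mul_inv_cancel hvx (by simp), mul_one]
      _ ≤ _ := by gcongr
  · have hq0 : 0 < q := by linarith
    have hpq := Real.HolderConjugate.conjExponent hq
    simp only [dualFactor, if_neg hq.ne']
    -- An average is an integral against the normalised measure, so Hölder applies with no volume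
    -- factors.
    simp only [laverage]
    have h := ENNReal.lintegral_mul_le_Lp_mul_Lq
      ((volume.restrict (ball c r) univ)⁻¹ • volume.restrict (ball c r)) hpq
      (f := fun x => F x * (v x : ℝ≥0∞) ^ (1 / q)) (g := fun x => (v x : ℝ≥0∞) ^ (-(1 / q)))
      (by fun_prop) (by fun_prop)
    convert h using 2
    · funext x
      have hvx : (v x : ℝ≥0∞) ≠ 0 := by simpa using hv0 x
      simp only [Pi.mul_apply]
      rw [mul_assoc, ← ENNReal.rpow_add _ _ hvx (by simp)]
      simp
    · congr 2 with x
      rw [ENNReal.mul_rpow_of_nonneg _ _ hq0.le, ← ENNReal.rpow_mul, one_div,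
        inv_mul_cancel₀ hq0.ne', ENNReal.rpow_one]
    · congr 2 with x
      rw [← ENNReal.rpow_mul]
      congr 1
      rw [Real.conjExponent]
      have : q - 1 ≠ 0 := by linarith
      field_simp
      ring

/-- The `A_q` condition with constant `K` for balls of radius at most `R`, together with
measurability and positivity of the weights. -/
structure IsLocalWeight (q : Fin m → ℝ) (w : Fin m → EuclideanSpace ℝ (Fin n) → ℝ≥0) (R : ℝ)
    (K : ℝ≥0∞) : Prop where
  measurable : ∀ j, Measurable (w j)
  ne_zero : ∀ j x, w j x ≠ 0
  one_le : ∀ j, 1 ≤ q j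
  ne_top : K ≠ ∞
  bound : ∀ c r, 0 < r → r ≤ R →
    (⨍⁻ x in ball c r, productWeight q w x ∂volume) ^ (1 / harmonicExponent q) *
      ∏ j, dualFactor (q j) (w j) c r ≤ K

namespace IsLocalWeight

variable {q : Fin m → ℝ} {w : Fin m → EuclideanSpace ℝ (Fin n) → ℝ≥0} {R : ℝ} {K : ℝ≥0∞}

theorem pos (h : IsLocalWeight q w R K) (j : Fin m) : 0 < q j :=
  zero_lt_one.trans_le (h.one_le j)

theorem measurable_coe (h : IsLocalWeight q w R K) (j : Fin m) :
    Measurable fun x => (w j x : ℝ≥0∞) := (h.measurable j).coe_nnreal_ennreal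

/-- Hölder in each average brings out the dual factors that occur in the A_q condition. The volume
powers `|B|^(1/q_j)` multiply to `|B|^(1/q)` and cancel the normalisation of the average of `ν`. -/
theorem rpow_mul_prod_setLAverage_le (h : IsLocalWeight q w R K)
    {F : Fin m → EuclideanSpace ℝ (Fin n) → ℝ≥0∞} (hF : ∀ j, Measurable (F j))
    (c : EuclideanSpace ℝ (Fin n)) {r : ℝ} (hr : 0 < r) (hrR : r ≤ R) :
    volume.withDensity (productWeight q w) (ball c r) ^ (1 / harmonicExponent q) *
        ∏ j, ⨍⁻ x in ball c r, F j x ∂volume ≤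
      K * ∏ j, (∫⁻ x in ball c r, F j x ^ q j * w j x ∂volume) ^ (1 / q j) := by
  have hB0 : volume (ball c r) ≠ 0 := (measure_ball_pos _ _ hr).ne'
  have hBt : volume (ball c r) ≠ ∞ := measure_ball_lt_top.ne
  have hQ : 0 ≤ 1 / harmonicExponent q := by
    rw [inv_harmonicExponent]; exact Finset.sum_nonneg fun j _ => inv_nonneg.2 (h.pos j).le
  rw [withDensity_apply _ isOpen_ball.measurableSet]
  set V := volume (ball c r)
  set N := ∫⁻ x in ball c r, productWeight q w x ∂volume with hN
  set I := fun j => ∫⁻ x in ball c r, F j x ^ q j * w j x ∂volume with hI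
  have hV : ∏ j, V ^ (1 / q j) = V ^ (1 / harmonicExponent q) := by
    rw [ENNReal.prod_rpow_eq_rpow_sum _ _ fun j _ => by have := h.pos j; positivity,
      inv_harmonicExponent]
    simp
  have hV0 : V ^ (1 / harmonicExponent q) ≠ 0 := by simp [hB0, hBt]
  have hVt : V ^ (1 / harmonicExponent q) ≠ ∞ := by simp [hB0, hBt]
  calc N ^ (1 / harmonicExponent q) * ∏ j, ⨍⁻ x in ball c r, F j x ∂volume
      ≤ N ^ (1 / harmonicExponent q) *
          ∏ j, ((I j / V) ^ (1 / q j) * dualFactor (q j) (w j) c r) := by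
        gcongr with j
        refine (setLAverage_le_mul_dualFactor (h.one_le j) (h.measurable j) (h.ne_zero j) (hF j)
          c r).trans_eq ?_
        rw [setLAverage_eq]
    _ = N ^ (1 / harmonicExponent q) * ((∏ j, I j ^ (1 / q j)) / V ^ (1 / harmonicExponent q)) *
          ∏ j, dualFactor (q j) (w j) c r := by
        rw [Finset.prod_mul_distrib, ← mul_assoc]
        congr 2
        rw [← hV, div_eq_mul_inv, ENNReal.prod_inv_distrib, ← Finset.prod_mul_distrib]
        · refine Finset.prod_congr rfl fun j _ => ?_
          rw [ENNReal.div_rpow_of_nonneg _ _ (by have := h.pos j; positivity), div_eq_mul_inv]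
        · intro i _ j _ _
          left; simp [hB0, hBt]
    _ = ((N / V) ^ (1 / harmonicExponent q) * ∏ j, dualFactor (q j) (w j) c r) *
          ∏ j, I j ^ (1 / q j) := by
        rw [ENNReal.div_rpow_of_nonneg _ _ hQ]
        simp only [div_eq_mul_inv, one_mul]
        ring
    _ ≤ _ := by
        gcongr
        have := h.bound c r hr hrR
        rwa [setLAverage_eq] at this

/-- The previous estimate is tested on functions supported in `A` with product 1, whose integrals
over `A` Hölder bounds below by `|A|`. The dual weights are not used, so `q_j = 1` is allowed, as
the weak type bound requires. -/
theorem withDensity_apply_le (h : IsLocalWeight q w R K) (hm : 1 ≤ m)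
    {c : EuclideanSpace ℝ (Fin n)} {r : ℝ} (hr : 0 < r) (hrR : r ≤ R)
    {A : Set (EuclideanSpace ℝ (Fin n))} (hA : MeasurableSet A) (hAB : A ⊆ ball c r) {b : ℝ≥0∞}
    (hb : volume (ball c r) ≤ b * volume A) :
    volume.withDensity (productWeight q w) (ball c r) ≤
      (K * b ^ m) ^ harmonicExponent q * volume.withDensity (productWeight q w) A := by
  have hQ := harmonicExponent_pos hm h.pos
  have hB0 : volume (ball c r) ≠ 0 := (measure_ball_pos _ _ hr).ne'
  have hBt : volume (ball c r) ≠ ∞ := measure_ball_lt_top.ne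
  have hA0 : volume A ≠ 0 := fun h0 => hB0 (by simpa [h0] using hb)
  have hAt : volume A ≠ ∞ := ((measure_mono hAB).trans_lt measure_ball_lt_top).ne
  have hν0 : ∀ x, productWeight q w x ≠ 0 := fun x => productWeight_ne_zero fun j => h.ne_zero j x
  have hνt : ∀ x, productWeight q w x ≠ ∞ := fun x => productWeight_ne_top fun j => h.ne_zero j x
  have hνm : Measurable (productWeight q w) := measurable_productWeight h.measurable
  have hw0 : ∀ j x, (w j x : ℝ≥0∞) ≠ 0 := fun j x => by simpa using h.ne_zero j x
  -- Chosen so that `g_j^{q_j} w_j = ν` for every `j`, while `∏ g_j = ν^(1/q) / ∏ w_j^(1/q_j) = 1`.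
  set g : Fin m → EuclideanSpace ℝ (Fin n) → ℝ≥0∞ :=
    fun j x => (productWeight q w x / w j x) ^ (1 / q j) with hg
  have hgm : ∀ j, Measurable (g j) := fun j =>
    (hνm.div (h.measurable_coe j)).pow_const _
  have hprod : ∀ x, ∏ j, g j x ^ (1 : ℝ) = 1 := by
    intro x
    simp only [ENNReal.rpow_one, hg]
    have h1 : ∏ j, (productWeight q w x) ^ (1 / q j)
        = productWeight q w x ^ (1 / harmonicExponent q) := by
      rw [ENNReal.prod_rpow_eq_rpow_sum _ _ fun j _ => by have := h.pos j; positivity,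
        inv_harmonicExponent]
      simp
    have h2 : ∏ j, (w j x : ℝ≥0∞) ^ (1 / q j)
        = productWeight q w x ^ (1 / harmonicExponent q) := by
      rw [productWeight, ← ENNReal.prod_rpow_of_nonneg (by positivity)]
      refine Finset.prod_congr rfl fun j _ => ?_
      rw [← ENNReal.rpow_mul]
      congr 1
      field_simp
    have h3 : ∀ j, (productWeight q w x / w j x) ^ (1 / q j) =
        productWeight q w x ^ (1 / q j) * ((w j x : ℝ≥0∞) ^ (1 / q j))⁻¹ := fun j => by
      rw [ENNReal.div_rpow_of_nonneg _ _ (by have := h.pos j; positivity), div_eq_mul_inv]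
    simp_rw [h3]
    rw [Finset.prod_mul_distrib, ← ENNReal.prod_inv_distrib, h1, h2, ENNReal.mul_inv_cancel]
    · simp [hν0, hνt]
    · simp [hν0, hνt]
    · intro i _ j _ _
      left; simp [h.ne_zero]
  have hlow := measure_univ_pow_le_prod_lintegral_rpow (μ := volume.restrict A) (m := m)
    (by omega) hgm
    (a := fun _ => 1) (by simp) (by simp) hprod
  simp only [Measure.restrict_apply_univ, ENNReal.rpow_one] at hlow
  have hH := h.rpow_mul_prod_setLAverage_le (F := fun j => A.indicator (g j))
    (fun j => (hgm j).indicator hA) c hr hrR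
  have hup : ∀ j, ∫⁻ x in ball c r, A.indicator (g j) x ^ q j * w j x ∂volume
      = volume.withDensity (productWeight q w) A := by
    intro j
    rw [withDensity_apply _ hA, ← inter_eq_self_of_subset_left hAB,
      ← Measure.restrict_restrict hA, ← lintegral_indicator hA]
    rw [inter_eq_self_of_subset_left hAB]
    refine lintegral_congr fun x => ?_
    by_cases hx : x ∈ A
    · rw [indicator_of_mem hx, indicator_of_mem hx, hg, ← ENNReal.rpow_mul, one_div,
        inv_mul_cancel₀ (h.pos j).ne', ENNReal.rpow_one,
        ENNReal.div_mul_cancel (hw0 j x) (by simp)]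
    · rw [indicator_of_notMem hx, indicator_of_notMem hx, ENNReal.zero_rpow_of_pos (h.pos j),
        zero_mul]
  have havg : ∀ j, ⨍⁻ x in ball c r, A.indicator (g j) x ∂volume =
      (∫⁻ x in A, g j x ∂volume) / volume (ball c r) := by
    intro j
    rw [setLAverage_eq, lintegral_indicator hA, Measure.restrict_restrict hA,
      inter_eq_self_of_subset_left hAB]
  simp only [hup, havg] at hH
  rw [ENNReal.prod_rpow_eq_rpow_sum _ _ fun j _ => by have := h.pos j; positivity] at hH
  simp only [one_div] at hH
  rw [← inv_harmonicExponent] at hH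
  set N := volume.withDensity (productWeight q w)
  set Q := harmonicExponent q
  have key : N (ball c r) ^ (1 / Q) * volume A ^ m ≤ (K * b ^ m * N A ^ (1 / Q)) * volume A ^ m := by
    calc N (ball c r) ^ (1 / Q) * volume A ^ m
        ≤ N (ball c r) ^ (1 / Q) * ∏ j, ∫⁻ x in A, g j x ∂volume := by gcongr
      _ = N (ball c r) ^ (1 / Q) * (∏ j, (∫⁻ x in A, g j x ∂volume) / volume (ball c r)) *
            volume (ball c r) ^ m := by
          have : volume (ball c r) ^ m = ∏ _j : Fin m, volume (ball c r) := by simp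
          rw [this, mul_assoc, ← Finset.prod_mul_distrib]
          simp only [ENNReal.div_mul_cancel hB0 hBt]
      _ ≤ (K * N A ^ (1 / Q)) * (b * volume A) ^ m := by
          refine mul_le_mul' ?_ (pow_le_pow_left' hb m)
          simpa only [one_div] using hH
      _ = _ := by rw [mul_pow]; ring
  have key2 := (ENNReal.mul_le_mul_iff_left (pow_ne_zero m hA0) (ENNReal.pow_ne_top hAt)).1 key
  calc N (ball c r) = (N (ball c r) ^ (1 / Q)) ^ Q := by
        rw [← ENNReal.rpow_mul, one_div_mul_cancel hQ.ne', ENNReal.rpow_one]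
    _ ≤ (K * b ^ m * N A ^ (1 / Q)) ^ Q := by gcongr
    _ = _ := by
        rw [ENNReal.mul_rpow_of_nonneg _ _ hQ.le, ← ENNReal.rpow_mul (N A),
          one_div_mul_cancel hQ.ne', ENNReal.rpow_one]

theorem _root_.EuclideanSpace.volume_ball_mul_six (c : EuclideanSpace ℝ (Fin n)) {r : ℝ} :
    volume (ball c (6 * r)) = ENNReal.ofReal (6 ^ n) * volume (ball c r) := by
  have := Measure.addHaar_ball_mul_of_pos (volume : Measure (EuclideanSpace ℝ (Fin n))) c
    (r := 6) (by norm_num) r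
  rw [this, finrank_euclideanSpace_fin]
  congr 1
  exact (Measure.addHaar_ball_center _ _ _).symm

theorem locallyDoubling (h : IsLocalWeight q w R K) (hm : 1 ≤ m) :
    LocallyDoubling (volume.withDensity (productWeight q w)) (R / 6)
      ((K * ENNReal.ofReal (6 ^ n) ^ m) ^ harmonicExponent q) := fun c r hr hrR =>
  h.withDensity_apply_le hm (by positivity) (by linarith) isOpen_ball.measurableSet
    (ball_subset_ball (by linarith)) (EuclideanSpace.volume_ball_mul_six c).le

end IsLocalWeight

/-- The multilinear maximal function over balls of radius at most `R`. -/
noncomputable def averageMaximal (R : ℝ) (F : Fin m → EuclideanSpace ℝ (Fin n) → ℝ≥0∞) :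
    EuclideanSpace ℝ (Fin n) → ℝ≥0∞ :=
  ballSup R fun c r => ∏ j, ⨍⁻ z in ball c r, F j z ∂volume

/-- On each selected Vitali ball the product of averages exceeds `b`, so `b^q ν(B)` is controlled by
the one-ball estimate. Disjointness and discrete Hölder then recover the full integrals. -/
theorem IsLocalWeight.rpow_mul_measure_lt_averageMaximal_le {q : Fin m → ℝ}
    {w : Fin m → EuclideanSpace ℝ (Fin n) → ℝ≥0} {R : ℝ} {K : ℝ≥0∞}
    (h : IsLocalWeight q w R K) (hm : 1 ≤ m)
    {F : Fin m → EuclideanSpace ℝ (Fin n) → ℝ≥0∞} (hF : ∀ j, Measurable (F j)) (b : ℝ≥0∞) :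
    b ^ harmonicExponent q *
        volume.withDensity (productWeight q w) {x | b < averageMaximal (R / 6) F x} ≤
      (K * ENNReal.ofReal (6 ^ n) ^ m) ^ harmonicExponent q * K ^ harmonicExponent q *
        ∏ j, (∫⁻ x, F j x ^ q j * w j x ∂volume) ^ (harmonicExponent q / q j) := by
  have hQ := harmonicExponent_pos hm h.pos
  obtain ⟨u, hc, hu, hd, hle⟩ := exists_disjoint_balls_of_lt_ballSup (h.locallyDoubling hm)
    (fun c r => ∏ j, ⨍⁻ z in ball c r, F j z ∂volume) b
  have := hc.to_subtype
  set N := volume.withDensity (productWeight q w)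
  set Q := harmonicExponent q
  set D := (K * ENNReal.ofReal (6 ^ n) ^ m) ^ Q
  calc b ^ Q * N {x | b < averageMaximal (R / 6) F x}
      ≤ b ^ Q * (D * ∑' a : u, N (ball a.1.1 a.1.2)) := by gcongr; exact hle
    _ = D * ∑' a : u, b ^ Q * N (ball a.1.1 a.1.2) := by rw [ENNReal.tsum_mul_left]; ring
    _ ≤ D * ∑' a : u, K ^ Q * ∏ j,
          (∫⁻ x in ball a.1.1 a.1.2, F j x ^ q j * w j x ∂volume) ^ (Q / q j) := by
        gcongr D * ?_
        refine ENNReal.tsum_le_tsum fun a => ?_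
        obtain ⟨h0, h1, h2⟩ := hu a.1 a.2
        have hH := h.rpow_mul_prod_setLAverage_le hF a.1.1 h0 (by linarith)
        have h3 : N (ball a.1.1 a.1.2) ^ (1 / Q) * b ≤ K * ∏ j,
            (∫⁻ x in ball a.1.1 a.1.2, F j x ^ q j * w j x ∂volume) ^ (1 / q j) :=
          le_trans (by gcongr) hH
        have h4 := ENNReal.rpow_le_rpow h3 hQ.le
        rw [ENNReal.mul_rpow_of_nonneg _ _ hQ.le, ENNReal.mul_rpow_of_nonneg _ _ hQ.le,
          ← ENNReal.rpow_mul, one_div_mul_cancel hQ.ne', ENNReal.rpow_one, mul_comm,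
          ← ENNReal.prod_rpow_of_nonneg hQ.le] at h4
        refine h4.trans_eq ?_
        congr 1
        refine Finset.prod_congr rfl fun j _ => ?_
        rw [← ENNReal.rpow_mul]
        congr 1
        ring
    _ = D * K ^ Q * ∑' a : u, ∏ j,
          (∫⁻ x in ball a.1.1 a.1.2, F j x ^ q j * w j x ∂volume) ^ (Q / q j) := by
        rw [ENNReal.tsum_mul_left, mul_assoc]
    _ ≤ D * K ^ Q * ∏ j, (∑' a : u,
          ∫⁻ x in ball a.1.1 a.1.2, F j x ^ q j * w j x ∂volume) ^ (Q / q j) := by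
        gcongr
        exact ENNReal.tsum_prod_rpow_le _ _ (sum_harmonicExponent_div hm h.pos)
          fun j _ => div_nonneg hQ.le (h.pos j).le
    _ ≤ _ := by
        gcongr with j
        · exact div_nonneg hQ.le (h.pos j).le
        · exact tsum_setLIntegral_le_of_pairwiseDisjoint hc hd _

end HolderWeights

/-! ### Balanced systems of weights -/

theorem ae_restrict_ball_neBot {n : ℕ} (c : EuclideanSpace ℝ (Fin n)) {r : ℝ} (hr : 0 < r) :
    (ae (volume.restrict (ball c r))).NeBot := by
  rw [ae_neBot, Ne, Measure.restrict_eq_zero]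
  exact (measure_ball_pos _ _ hr).ne'

/-- Positive functions with weighted geometric mean `1` whose averages over balls of radius at
most `R` have bounded weighted geometric mean. -/
structure BalancedWeights {ι : Type*} [Fintype ι] {n : ℕ} (m : ℕ) (a : ι → ℝ)
    (g : ι → EuclideanSpace ℝ (Fin n) → ℝ≥0∞) (R : ℝ) (K : ℝ≥0∞) : Prop where
  pos : m ≠ 0
  measurable : ∀ i, Measurable (g i)
  ne_zero : ∀ i x, g i x ≠ 0
  exponent_pos : ∀ i, 0 < a i
  sum_eq : ∑ i, a i = m
  prod_eq_one : ∀ x, ∏ i, g i x ^ a i = 1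
  ne_top : K ≠ ∞
  bound : ∀ c r, 0 < r → r ≤ R →
    ∏ i, volume.withDensity (g i) (ball c r) ^ a i ≤ K * volume (ball c r) ^ m

namespace BalancedWeights

variable {ι : Type*} [Fintype ι] {n m : ℕ} {a : ι → ℝ}
  {g : ι → EuclideanSpace ℝ (Fin n) → ℝ≥0∞} {R : ℝ} {K : ℝ≥0∞}
  {c : EuclideanSpace ℝ (Fin n)} {r : ℝ}

theorem withDensity_ball_ne_zero (h : BalancedWeights m a g R K) (i : ι) (hr : 0 < r) :
    volume.withDensity (g i) (ball c r) ≠ 0 := by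
  rw [withDensity_apply _ isOpen_ball.measurableSet]
  intro h0
  rw [lintegral_eq_zero_iff (h.measurable i)] at h0
  have := ae_restrict_ball_neBot c hr
  obtain ⟨x, hx⟩ := h0.exists
  exact h.ne_zero i x hx

/-- Local integrability is a consequence of the bound: the other factors are nonzero, so one
infinite mass would make the product infinite. -/
theorem withDensity_ball_ne_top (h : BalancedWeights m a g R K) (i : ι) (hr : 0 < r)
    (hrR : r ≤ R) : volume.withDensity (g i) (ball c r) ≠ ∞ := by
  classical
  intro ht
  have hb := h.bound c r hr hrR
  have hlt : K * volume (ball c r) ^ m < ∞ :=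
    ENNReal.mul_lt_top h.ne_top.lt_top (ENNReal.pow_lt_top measure_ball_lt_top)
  rw [← Finset.mul_prod_erase _ _ (Finset.mem_univ i), ht,
    ENNReal.top_rpow_of_pos (h.exponent_pos i), ENNReal.top_mul] at hb
  · exact absurd (hb.trans_lt hlt) (lt_irrefl _)
  · refine Finset.prod_ne_zero_iff.2 fun k _ => ?_
    simp [ENNReal.rpow_eq_zero_iff, h.withDensity_ball_ne_zero k hr, (h.exponent_pos k).not_gt]

/-- Hölder on `A` bounds `|A|^m` by the product of the masses of `A`. Enlarging `A` to the ball in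
every factor except the `i`-th leaves the product over the ball once the missing mass is multiplied
in. -/
theorem volume_pow_mul_le (h : BalancedWeights m a g R K) (i : ι) (hr : 0 < r) (hrR : r ≤ R)
    {A : Set (EuclideanSpace ℝ (Fin n))} (hA : MeasurableSet A) (hAB : A ⊆ ball c r) :
    volume A ^ m * volume.withDensity (g i) (ball c r) ^ a i ≤
      K * volume (ball c r) ^ m * volume.withDensity (g i) A ^ a i := by
  classical
  have hlow := measure_univ_pow_le_prod_lintegral_rpow (μ := volume.restrict A) h.pos h.measurable
    (fun i => (h.exponent_pos i).le) h.sum_eq h.prod_eq_one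
  simp only [Measure.restrict_apply_univ, ← withDensity_apply _ hA] at hlow
  calc volume A ^ m * volume.withDensity (g i) (ball c r) ^ a i
      ≤ (∏ k, volume.withDensity (g k) A ^ a k) * volume.withDensity (g i) (ball c r) ^ a i := by
        gcongr
    _ = volume.withDensity (g i) A ^ a i * ((∏ k ∈ Finset.univ.erase i,
          volume.withDensity (g k) A ^ a k) * volume.withDensity (g i) (ball c r) ^ a i) := by
        rw [← Finset.mul_prod_erase _ _ (Finset.mem_univ i), mul_assoc]
    _ ≤ volume.withDensity (g i) A ^ a i * ((∏ k ∈ Finset.univ.erase i,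
          volume.withDensity (g k) (ball c r) ^ a k) *
            volume.withDensity (g i) (ball c r) ^ a i) := by
        gcongr with k
        exact (h.exponent_pos k).le
    _ = volume.withDensity (g i) A ^ a i * ∏ k, volume.withDensity (g k) (ball c r) ^ a k := by
        rw [← Finset.mul_prod_erase _ _ (Finset.mem_univ i), mul_comm (∏ k ∈ _, _)]
    _ ≤ volume.withDensity (g i) A ^ a i * (K * volume (ball c r) ^ m) := by
        gcongr
        exact h.bound c r hr hrR
    _ = _ := mul_comm _ _

theorem withDensity_apply_le (h : BalancedWeights m a g R K) (i : ι) (hr : 0 < r) (hrR : r ≤ R)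
    {A : Set (EuclideanSpace ℝ (Fin n))} (hA : MeasurableSet A) (hAB : A ⊆ ball c r) {b : ℝ≥0∞}
    (hb : volume (ball c r) ≤ b * volume A) :
    volume.withDensity (g i) (ball c r) ≤
      (K * b ^ m) ^ (1 / a i) * volume.withDensity (g i) A := by
  have hB0 : volume (ball c r) ≠ 0 := (measure_ball_pos _ _ hr).ne'
  have hA0 : volume A ≠ 0 := fun h0 => hB0 (by simpa [h0] using hb)
  have hAt : volume A ≠ ∞ := ((measure_mono hAB).trans_lt measure_ball_lt_top).ne
  set N := volume.withDensity (g i)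
  have ha := h.exponent_pos i
  have key : N (ball c r) ^ a i * volume A ^ m ≤ (K * b ^ m * N A ^ a i) * volume A ^ m := by
    calc N (ball c r) ^ a i * volume A ^ m ≤ K * volume (ball c r) ^ m * N A ^ a i := by
          rw [mul_comm]; exact h.volume_pow_mul_le i hr hrR hA hAB
      _ ≤ K * (b * volume A) ^ m * N A ^ a i := by gcongr
      _ = _ := by rw [mul_pow]; ring
  have key2 := (ENNReal.mul_le_mul_iff_left (pow_ne_zero m hA0) (ENNReal.pow_ne_top hAt)).1 key
  calc N (ball c r) = (N (ball c r) ^ a i) ^ (1 / a i) := by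
        rw [← ENNReal.rpow_mul, mul_one_div_cancel ha.ne', ENNReal.rpow_one]
    _ ≤ (K * b ^ m * N A ^ a i) ^ (1 / a i) := by gcongr
    _ = _ := by
        rw [ENNReal.mul_rpow_of_nonneg _ _ (by positivity), ← ENNReal.rpow_mul (N A),
          mul_one_div_cancel ha.ne', ENNReal.rpow_one]

theorem locallyDoubling (h : BalancedWeights m a g R K) (i : ι) :
    LocallyDoubling (volume.withDensity (g i)) (R / 6)
      ((K * ENNReal.ofReal (6 ^ n) ^ m) ^ (1 / a i)) := fun c r hr hrR =>
  h.withDensity_apply_le i (by positivity) (by linarith) isOpen_ball.measurableSet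
    (ball_subset_ball (by linarith)) (EuclideanSpace.volume_ball_mul_six c).le

/-- Where the weight is at most `l` times its average, its mass is at most `l` times that of the
ball; by the comparison of masses such a set is small when `l` is. -/
theorem volume_setOf_le_pow_le (h : BalancedWeights m a g R K) (i : ι) (hr : 0 < r) (hrR : r ≤ R)
    (l : ℝ≥0∞) :
    volume {y ∈ ball c r | g i y ≤ l * (volume.withDensity (g i) (ball c r) / volume (ball c r))}
      ^ m ≤ K * l ^ a i * volume (ball c r) ^ m := by
  set N := volume.withDensity (g i) (ball c r) with hN
  set A := {y ∈ ball c r | g i y ≤ l * (N / volume (ball c r))} with hAdef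
  have hA : MeasurableSet A :=
    isOpen_ball.measurableSet.inter (measurableSet_le (h.measurable i) measurable_const)
  have hAB : A ⊆ ball c r := fun y hy => hy.1
  have hB0 : volume (ball c r) ≠ 0 := (measure_ball_pos _ _ hr).ne'
  have hBt : volume (ball c r) ≠ ∞ := measure_ball_lt_top.ne
  have hNA : volume.withDensity (g i) A ≤ l * N := by
    rw [withDensity_apply _ hA]
    calc ∫⁻ y in A, g i y ∂volume ≤ ∫⁻ _y in A, l * (N / volume (ball c r)) ∂volume :=
          setLIntegral_mono' hA fun y hy => hy.2
      _ = l * (N / volume (ball c r)) * volume A := setLIntegral_const _ _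
      _ ≤ l * (N / volume (ball c r)) * volume (ball c r) := by gcongr
      _ = l * N := by rw [mul_assoc, ENNReal.div_mul_cancel hB0 hBt]
  have ha := h.exponent_pos i
  have hN0 : N ^ a i ≠ 0 := by
    simp [ENNReal.rpow_eq_zero_iff, hN, h.withDensity_ball_ne_zero i hr, ha.not_gt]
  have hNt : N ^ a i ≠ ∞ :=
    ENNReal.rpow_ne_top_of_nonneg ha.le (h.withDensity_ball_ne_top i hr hrR)
  refine (ENNReal.mul_le_mul_iff_left hN0 hNt).1 ?_
  calc volume A ^ m * N ^ a i ≤ K * volume (ball c r) ^ m * volume.withDensity (g i) A ^ a i :=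
        h.volume_pow_mul_le i hr hrR hA hAB
    _ ≤ K * volume (ball c r) ^ m * (l * N) ^ a i := by gcongr
    _ = _ := by rw [ENNReal.mul_rpow_of_nonneg _ _ ha.le]; ring

/-- On a large part of any small ball all the weights are bounded below by their averages. -/
theorem exists_large_subset (h : BalancedWeights m a g R K) :
    ∃ l : ι → ℝ≥0∞, (∀ i, l i ≠ 0 ∧ l i ≠ ∞) ∧ ∀ c r, 0 < r → r ≤ R →
      ∃ A ⊆ ball c r, MeasurableSet A ∧ volume (ball c r) ≤ 2 * volume A ∧
        ∀ y ∈ A, ∀ i, l i * (volume.withDensity (g i) (ball c r) / volume (ball c r)) ≤ g i y := by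
  -- Each bad set will have measure at most `|B|/M`, so together they fill at most half of the ball.
  -- The thresholds `e^(1/a_i)` turn the sublevel bound into `K e ≤ M^(-m)`; the `+ 1` in `K + 1`
  -- avoids division by zero.
  set M : ℝ≥0∞ := 2 * (Fintype.card ι + 1) with hM
  have hMt : M ≠ ∞ := ENNReal.mul_ne_top (by simp) (by simp)
  have hM0 : M ≠ 0 := by simp [hM]
  set e : ℝ≥0∞ := M⁻¹ ^ m / (K + 1) with he
  have he0 : e ≠ 0 := by simp [he, hMt, h.ne_top, ENNReal.div_eq_zero_iff]
  have het : e ≠ ∞ := ENNReal.div_ne_top (by simp [hM0]) (by simp)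
  have hKe : K * e ≤ M⁻¹ ^ m := by
    calc K * e ≤ (K + 1) * e := by gcongr; exact le_self_add
      _ = _ := by rw [he, ENNReal.mul_div_cancel (by simp) (by simp [h.ne_top])]
  refine ⟨fun i => e ^ (1 / a i), fun i => ⟨by simp [ENNReal.rpow_eq_zero_iff, he0, het],
    by simp [ENNReal.rpow_eq_top_iff, he0, het]⟩, fun c r hr hrR => ?_⟩
  set G : ι → ℝ≥0∞ := fun i => volume.withDensity (g i) (ball c r) / volume (ball c r)
  set T : ι → Set (EuclideanSpace ℝ (Fin n)) :=
    fun i => {y ∈ ball c r | g i y ≤ e ^ (1 / a i) * G i}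
  have hT : ∀ i, MeasurableSet (T i) := fun i =>
    isOpen_ball.measurableSet.inter (measurableSet_le (h.measurable i) measurable_const)
  have hTv : ∀ i, volume (T i) ≤ M⁻¹ * volume (ball c r) := by
    intro i
    have h1 := h.volume_setOf_le_pow_le (c := c) i hr hrR (e ^ (1 / a i))
    rw [← ENNReal.rpow_mul, one_div_mul_cancel (h.exponent_pos i).ne', ENNReal.rpow_one] at h1
    have h2 : volume (T i) ^ m ≤ (M⁻¹ * volume (ball c r)) ^ m := by
      rw [mul_pow]
      exact h1.trans (by gcongr)
    exact (ENNReal.pow_le_pow_left_iff h.pos).1 h2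
  refine ⟨ball c r \ ⋃ i, T i, sdiff_subset, isOpen_ball.measurableSet.diff
    (MeasurableSet.iUnion hT), ?_, ?_⟩
  · have hBt : volume (ball c r) ≠ ∞ := measure_ball_lt_top.ne
    have hU : volume (⋃ i, T i) ≤ volume (ball c r) / 2 := by
      calc volume (⋃ i, T i) ≤ ∑ i, volume (T i) := measure_iUnion_fintype_le _ _
        _ ≤ ∑ _i : ι, M⁻¹ * volume (ball c r) := Finset.sum_le_sum fun i _ => hTv i
        _ = Fintype.card ι * M⁻¹ * volume (ball c r) := by simp [mul_assoc]
        _ ≤ (Fintype.card ι + 1) * M⁻¹ * volume (ball c r) := by gcongr; exact le_self_add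
        _ = volume (ball c r) / 2 := by
            rw [hM, ENNReal.mul_inv (by simp) (by simp), mul_left_comm,
              ENNReal.mul_inv_cancel (by simp) (by simp), mul_one, mul_comm, div_eq_mul_inv]
    have h1 : volume (ball c r) ≤ volume (ball c r \ ⋃ i, T i) + volume (ball c r) / 2 :=
      (measure_le_inter_add_sdiff _ _ (⋃ i, T i)).trans (by
        rw [add_comm]; gcongr; exact (measure_mono inter_subset_right).trans hU)
    have h2 : volume (ball c r) / 2 ≤ volume (ball c r \ ⋃ i, T i) := by
      have ht : volume (ball c r) / 2 ≠ ∞ := ENNReal.div_ne_top hBt two_ne_zero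
      refine (ENNReal.add_le_add_iff_right ht).1 ?_
      rwa [ENNReal.add_halves]
    rw [mul_comm]
    exact (ENNReal.div_le_iff_le_mul (Or.inl (by simp)) (Or.inl (by simp))).1 h2
  · intro y hy i
    by_contra hlt
    exact hy.2 (mem_iUnion.2 ⟨i, hy.1, (not_le.1 hlt).le⟩)

end BalancedWeights

/-! ### The dual weights as a balanced system -/

section DualSystem

variable {m n : ℕ}

/-- The weights `ν_w` and `σⱼ = wⱼ ^ (1 - qⱼ')`. -/
noncomputable def dualSystem (q : Fin m → ℝ) (w : Fin m → EuclideanSpace ℝ (Fin n) → ℝ≥0) :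
    Option (Fin m) → EuclideanSpace ℝ (Fin n) → ℝ≥0∞
  | none => productWeight q w
  | some j => fun x => (w j x : ℝ≥0∞) ^ (1 - (q j).conjExponent)

/-- The exponents `1 / q` and `1 / qⱼ'`. -/
noncomputable def dualExponent (q : Fin m → ℝ) : Option (Fin m) → ℝ
  | none => 1 / harmonicExponent q
  | some j => 1 / (q j).conjExponent

/-- The exponents add up to `∑ (1/q_j + 1/q_j') = m`, and each `w_j` cancels between `ν^(1/q)` and
`σ_j^(1/q_j')`. Strict inequality `q_j > 1` is what makes `σ_j` available. -/
theorem IsLocalWeight.balancedWeights {q : Fin m → ℝ}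
    {w : Fin m → EuclideanSpace ℝ (Fin n) → ℝ≥0} {R : ℝ} {K : ℝ≥0∞}
    (h : IsLocalWeight q w R K) (hm : 1 ≤ m) (hq : ∀ j, 1 < q j) :
    BalancedWeights m (dualExponent q) (dualSystem q w) R K := by
  have hQ := harmonicExponent_pos hm h.pos
  have hc : ∀ j, (q j).HolderConjugate (q j).conjExponent :=
    fun j => Real.HolderConjugate.conjExponent (hq j)
  have hsum : ∑ i, dualExponent q i = m := by
    simp only [Fintype.sum_option, dualExponent]
    rw [inv_harmonicExponent, ← Finset.sum_add_distrib]
    have : ∀ j, (q j)⁻¹ + 1 / (q j).conjExponent = 1 := fun j => by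
      rw [one_div]; exact (hc j).inv_add_inv_eq_one
    rw [Finset.sum_congr rfl fun j _ => this j]
    simp
  have hpos : ∀ i, 0 < dualExponent q i := by
    rintro (_ | j)
    · exact one_div_pos.2 hQ
    · exact one_div_pos.2 (hc j).symm.pos
  have hw0 : ∀ j x, (w j x : ℝ≥0∞) ≠ 0 := fun j x => by simpa using h.ne_zero j x
  refine ⟨by omega, ?_, ?_, hpos, hsum, ?_, h.ne_top, ?_⟩
  · rintro (_ | j)
    · exact measurable_productWeight h.measurable
    · exact (h.measurable_coe j).pow_const _
  · rintro (_ | j) x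
    · exact productWeight_ne_zero fun j => h.ne_zero j x
    · simp [dualSystem, ENNReal.rpow_eq_zero_iff, hw0]
  · intro x
    simp only [Fintype.prod_option, dualExponent, dualSystem]
    rw [productWeight, ← ENNReal.prod_rpow_of_nonneg (by positivity), ← Finset.prod_mul_distrib]
    refine Finset.prod_eq_one fun j _ => ?_
    rw [← ENNReal.rpow_mul, ← ENNReal.rpow_mul, ← ENNReal.rpow_add _ _ (hw0 j x) (by simp)]
    convert ENNReal.rpow_zero using 2
    have h1 := hq j
    have h2 : q j - 1 ≠ 0 := by linarith
    have h3 : q j ≠ 0 := by linarith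
    rw [Real.conjExponent]
    field_simp
    ring
  · intro c r hr hrR
    have hB0 : volume (ball c r) ≠ 0 := (measure_ball_pos _ _ hr).ne'
    have hBt : volume (ball c r) ≠ ∞ := measure_ball_lt_top.ne
    have hb := h.bound c r hr hrR
    have hd : ∀ j, dualFactor (q j) (w j) c r =
        (⨍⁻ x in ball c r, dualSystem q w (some j) x ∂volume) ^ dualExponent q (some j) :=
      fun j => by simp only [dualFactor, if_neg (hq j).ne', dualSystem, dualExponent]
    have hb' : ∏ i, (⨍⁻ x in ball c r, dualSystem q w i x ∂volume) ^ dualExponent q i ≤ K := by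
      rw [Fintype.prod_option]
      simp only [hd] at hb
      exact hb
    calc ∏ i, volume.withDensity (dualSystem q w i) (ball c r) ^ dualExponent q i
        = ∏ i, ((⨍⁻ x in ball c r, dualSystem q w i x ∂volume) ^ dualExponent q i *
            volume (ball c r) ^ dualExponent q i) := by
          refine Finset.prod_congr rfl fun i _ => ?_
          rw [← ENNReal.mul_rpow_of_nonneg _ _ (hpos i).le, setLAverage_eq,
            ENNReal.div_mul_cancel hB0 hBt, withDensity_apply _ isOpen_ball.measurableSet]
      _ = (∏ i, (⨍⁻ x in ball c r, dualSystem q w i x ∂volume) ^ dualExponent q i) *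
            volume (ball c r) ^ m := by
          rw [Finset.prod_mul_distrib, ENNReal.prod_rpow_eq_rpow_sum _ _ fun i _ => (hpos i).le,
            hsum, ENNReal.rpow_natCast]
      _ ≤ _ := by gcongr

end DualSystem

/-! ### The strong type bound -/

section StrongType

variable {m n : ℕ}

theorem lintegral_withDensity_div {μ : Measure (EuclideanSpace ℝ (Fin n))}
    {g F : EuclideanSpace ℝ (Fin n) → ℝ≥0∞} (hg : Measurable g) (hg0 : ∀ x, g x ≠ 0)
    (hgt : ∀ x, g x ≠ ∞) (hF : Measurable F) :
    ∫⁻ x, F x / g x ∂μ.withDensity g = ∫⁻ x, F x ∂μ := by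
  rw [show (fun x => F x / g x) = F / g from rfl,
    lintegral_withDensity_eq_lintegral_mul _ hg (hF.div hg)]
  exact lintegral_congr fun x => ENNReal.mul_div_cancel (hg0 x) (hgt x)

/-- The product of the weights `σⱼ` and the weighted maximal functions of `Fⱼ / σⱼ`. -/
noncomputable def dualMaximalProduct (q : Fin m → ℝ)
    (w : Fin m → EuclideanSpace ℝ (Fin n) → ℝ≥0) (R : ℝ)
    (F : Fin m → EuclideanSpace ℝ (Fin n) → ℝ≥0∞) (x : EuclideanSpace ℝ (Fin n)) : ℝ≥0∞ :=
  ∏ j, dualSystem q w (some j) x *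
    measureMaximal (volume.withDensity (dualSystem q w (some j))) R
      (fun y => F j y / dualSystem q w (some j) y) x

variable {q : Fin m → ℝ} {w : Fin m → EuclideanSpace ℝ (Fin n) → ℝ≥0} {R : ℝ} {K : ℝ≥0∞}
  {F : Fin m → EuclideanSpace ℝ (Fin n) → ℝ≥0∞}

theorem dualSystem_ne_zero (hw : ∀ j x, w j x ≠ 0) :
    ∀ i x, dualSystem q w i x ≠ 0
  | none, _ => productWeight_ne_zero fun j => hw j _
  | some j, x => by simp [dualSystem, ENNReal.rpow_eq_zero_iff, hw j x]

theorem dualSystem_ne_top (hw : ∀ j x, w j x ≠ 0) :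
    ∀ i x, dualSystem q w i x ≠ ∞
  | none, _ => productWeight_ne_top fun j => hw j _
  | some j, x => by simp [dualSystem, ENNReal.rpow_eq_top_iff, hw j x]

theorem measurable_dualSystem (hw : ∀ j, Measurable (w j)) :
    ∀ i, Measurable (dualSystem q w i)
  | none => measurable_productWeight hw
  | some j => (hw j).coe_nnreal_ennreal.pow_const _

theorem measurable_dualMaximalProduct (hw : ∀ j, Measurable (w j)) :
    Measurable (dualMaximalProduct q w R F) :=
  Finset.measurable_fun_prod _ fun j _ =>
    (measurable_dualSystem hw (some j)).mul (measurable_measureMaximal _ _ _)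

/-- Pointwise domination of the multilinear maximal function by a weighted maximal function. -/
theorem IsLocalWeight.exists_averageMaximal_rpow_le (h : IsLocalWeight q w R K) (hm : 1 ≤ m)
    (hq : ∀ j, 1 < q j) {d : ℝ} (hd : 0 < d) :
    ∃ C : ℝ≥0∞, C ≠ ∞ ∧ ∀ F : Fin m → EuclideanSpace ℝ (Fin n) → ℝ≥0∞, (∀ j, Measurable (F j)) →
      ∀ x, averageMaximal (R / 6) F x ^ d ≤
        C * measureMaximal (volume.withDensity (productWeight q w)) (R / 6)
          (fun y => dualMaximalProduct q w (R / 6) F y ^ d) x := by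
  have hb := h.balancedWeights hm hq
  obtain ⟨l, hl, hlA⟩ := hb.exists_large_subset
  set L : ℝ≥0∞ := ∏ j, l (some j) with hL
  have hL0 : L ≠ 0 := Finset.prod_ne_zero_iff.2 fun j _ => (hl _).1
  have hLt : L ≠ ∞ := ENNReal.prod_ne_top fun j _ => (hl _).2
  have hLd0 : L ^ d ≠ 0 := by simp [ENNReal.rpow_eq_zero_iff, hL0, hLt]
  have hLdt : L ^ d ≠ ∞ := ENNReal.rpow_ne_top_of_nonneg hd.le hLt
  set D : ℝ≥0∞ := (K * 2 ^ m) ^ (1 / dualExponent q none) with hD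
  have hDt : D ≠ ∞ := ENNReal.rpow_ne_top_of_nonneg
    (one_div_nonneg.2 (hb.exponent_pos none).le)
    (ENNReal.mul_ne_top h.ne_top (ENNReal.pow_ne_top (by simp)))
  refine ⟨(L ^ d)⁻¹ * D, ENNReal.mul_ne_top (by simp [hLd0]) hDt, fun F hF x => ?_⟩
  set ν := volume.withDensity (productWeight q w) with hν
  set H := dualMaximalProduct q w (R / 6) F with hH
  set X := measureMaximal ν (R / 6) (fun y => H y ^ d) x with hX
  have key : ∀ c r, 0 < r → r ≤ R / 6 → x ∈ ball c r →
      (∏ j, ⨍⁻ z in ball c r, F j z ∂volume) ^ d ≤ (L ^ d)⁻¹ * D * X := by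
    intro c r hr hr6 hx
    have hrR : r ≤ R := by linarith
    obtain ⟨A, hAB, hAm, hAv, hAl⟩ := hlA c r hr hrR
    set P := ∏ j, ⨍⁻ z in ball c r, F j z ∂volume with hP
    -- On `A` the average of `F_j` is `σ_j(B)/|B|` times a `σ_j`-average of `F_j/σ_j`. The first
    -- factor is at most a multiple of `σ_j(y)`, and the second at most the maximal function at `y`.
    have hPH : ∀ y ∈ A, L * P ≤ H y := by
      intro y hy
      rw [hL, hP, ← Finset.prod_mul_distrib]
      refine Finset.prod_le_prod' fun j _ => ?_
      set S := volume.withDensity (dualSystem q w (some j)) with hS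
      have hS0 : S (ball c r) ≠ 0 := hb.withDensity_ball_ne_zero _ hr
      have hSt : S (ball c r) ≠ ∞ := hb.withDensity_ball_ne_top _ hr hrR
      set Y := measureMaximal S (R / 6) (fun y => F j y / dualSystem q w (some j) y) y with hY
      have h1 : (S (ball c r))⁻¹ * ∫⁻ z in ball c r, F j z ∂volume ≤ Y := by
        have h2 := le_ballSup (Φ := fun c r => (S (ball c r))⁻¹ *
          ∫⁻ y in ball c r, F j y / dualSystem q w (some j) y ∂S) hr hr6 (hAB hy)
        rw [hS, restrict_withDensity isOpen_ball.measurableSet,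
          lintegral_withDensity_div (measurable_dualSystem h.measurable _)
            (dualSystem_ne_zero h.ne_zero _) (dualSystem_ne_top h.ne_zero _) (hF j)] at h2
        exact h2
      have h3 : ∫⁻ z in ball c r, F j z ∂volume ≤ S (ball c r) * Y := by
        calc ∫⁻ z in ball c r, F j z ∂volume
            = S (ball c r) * ((S (ball c r))⁻¹ * ∫⁻ z in ball c r, F j z ∂volume) := by
              rw [← mul_assoc, ENNReal.mul_inv_cancel hS0 hSt, one_mul]
          _ ≤ _ := by gcongr
      calc l (some j) * ⨍⁻ z in ball c r, F j z ∂volume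
          ≤ l (some j) * (S (ball c r) * Y / volume (ball c r)) := by
            rw [setLAverage_eq]; gcongr
        _ = l (some j) * (S (ball c r) / volume (ball c r)) * Y := by
            simp only [div_eq_mul_inv]; ring
        _ ≤ dualSystem q w (some j) y * Y := by gcongr; exact hAl y hy (some j)
    have hν0 : ν (ball c r) ≠ 0 := hb.withDensity_ball_ne_zero none hr
    have hνt : ν (ball c r) ≠ ∞ := hb.withDensity_ball_ne_top none hr hrR
    -- `A` fills half of the ball in volume, hence a fixed proportion of it in `ν`.
    have h4 : (L * P) ^ d * ν (ball c r) ≤ D * ∫⁻ y in ball c r, H y ^ d ∂ν := by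
      calc (L * P) ^ d * ν (ball c r) ≤ (L * P) ^ d * (D * ν A) := by
            gcongr
            exact hb.withDensity_apply_le none hr hrR hAm hAB hAv
        _ = D * ∫⁻ _y in A, (L * P) ^ d ∂ν := by rw [setLIntegral_const]; ring
        _ ≤ D * ∫⁻ y in A, H y ^ d ∂ν := by
            gcongr D * ?_
            exact setLIntegral_mono' hAm fun y hy => ENNReal.rpow_le_rpow (hPH y hy) hd.le
        _ ≤ _ := by
            gcongr D * ?_
            exact lintegral_mono_set hAB
    have h5 : (L * P) ^ d ≤ D * X := by
      calc (L * P) ^ d = (ν (ball c r))⁻¹ * ((L * P) ^ d * ν (ball c r)) := by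
            rw [mul_left_comm, ENNReal.inv_mul_cancel hν0 hνt, mul_one]
        _ ≤ (ν (ball c r))⁻¹ * (D * ∫⁻ y in ball c r, H y ^ d ∂ν) := by gcongr
        _ = D * ((ν (ball c r))⁻¹ * ∫⁻ y in ball c r, H y ^ d ∂ν) := by ring
        _ ≤ D * X := by
            gcongr
            exact le_ballSup (Φ := fun c r => (ν (ball c r))⁻¹ * ∫⁻ y in ball c r, H y ^ d ∂ν)
              hr hr6 hx
    calc P ^ d = (L ^ d)⁻¹ * (L * P) ^ d := by
          rw [ENNReal.mul_rpow_of_nonneg _ _ hd.le, ← mul_assoc,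
            ENNReal.inv_mul_cancel hLd0 hLdt, one_mul]
      _ ≤ (L ^ d)⁻¹ * (D * X) := by gcongr
      _ = _ := by rw [mul_assoc]
  have h6 : averageMaximal (R / 6) F x ≤ ((L ^ d)⁻¹ * D * X) ^ (1 / d) :=
    ballSup_le fun c r hr hr6 hx => by
      rw [one_div]
      exact (ENNReal.le_rpow_inv_iff hd).2 (key c r hr hr6 hx)
  rw [one_div] at h6
  exact (ENNReal.le_rpow_inv_iff hd).1 h6

/-- Splitting `σ_j^q = σ_j^(q/q_j') σ_j^(q/q_j)`, the first powers cancel `ν` by the pointwise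
identity. What remains is in the form needed for Hölder with exponents `q/q_j`. -/
theorem IsLocalWeight.dualMaximalProduct_rpow_mul (h : IsLocalWeight q w R K) (hm : 1 ≤ m)
    (hq : ∀ j, 1 < q j) (x : EuclideanSpace ℝ (Fin n)) :
    productWeight q w x * dualMaximalProduct q w (R / 6) F x ^ harmonicExponent q =
      ∏ j, (dualSystem q w (some j) x *
        measureMaximal (volume.withDensity (dualSystem q w (some j))) (R / 6)
          (fun y => F j y / dualSystem q w (some j) y) x ^ q j) ^ (harmonicExponent q / q j) := by
  have hb := h.balancedWeights hm hq
  have hQ := harmonicExponent_pos hm h.pos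
  have hone := hb.prod_eq_one x
  simp only [Fintype.prod_option, dualExponent] at hone
  have hone' : productWeight q w x * ∏ j, dualSystem q w (some j) x ^
      (harmonicExponent q / (q j).conjExponent) = 1 := by
    have h1 := congrArg (· ^ harmonicExponent q) hone
    simp only [ENNReal.one_rpow] at h1
    rw [ENNReal.mul_rpow_of_nonneg _ _ hQ.le, ← ENNReal.rpow_mul, one_div_mul_cancel hQ.ne',
      ENNReal.rpow_one, ← ENNReal.prod_rpow_of_nonneg hQ.le] at h1
    rw [← h1]
    congr 1
    refine Finset.prod_congr rfl fun j _ => ?_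
    rw [← ENNReal.rpow_mul]
    congr 1
    ring
  rw [dualMaximalProduct, ← ENNReal.prod_rpow_of_nonneg hQ.le]
  have h2 : ∀ j, (dualSystem q w (some j) x *
        measureMaximal (volume.withDensity (dualSystem q w (some j))) (R / 6)
          (fun y => F j y / dualSystem q w (some j) y) x) ^ harmonicExponent q =
      dualSystem q w (some j) x ^ (harmonicExponent q / (q j).conjExponent) *
        (dualSystem q w (some j) x *
        measureMaximal (volume.withDensity (dualSystem q w (some j))) (R / 6)
          (fun y => F j y / dualSystem q w (some j) y) x ^ q j) ^ (harmonicExponent q / q j) := by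
    intro j
    have hj := h.pos j
    have hc := (Real.HolderConjugate.conjExponent (hq j))
    rw [ENNReal.mul_rpow_of_nonneg _ _ hQ.le, ENNReal.mul_rpow_of_nonneg _ _ (by positivity),
      ← ENNReal.rpow_mul, ← mul_assoc, ← ENNReal.rpow_add _ _ (dualSystem_ne_zero h.ne_zero _ _)
        (dualSystem_ne_top h.ne_zero _ _)]
    congr 2
    · have := hc.inv_add_inv_eq_one
      rw [div_eq_mul_inv, div_eq_mul_inv, ← mul_add, add_comm, this, mul_one]
    · field_simp
  rw [Finset.prod_congr rfl fun j _ => h2 j, Finset.prod_mul_distrib, ← mul_assoc, hone', one_mul]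

/-- The strong type inequality for the multilinear maximal function over small balls. -/
theorem IsLocalWeight.exists_lintegral_averageMaximal_rpow_le (h : IsLocalWeight q w R K)
    (hm : 1 ≤ m) (hq : ∀ j, 1 < q j) :
    ∃ C : ℝ≥0∞, C ≠ ∞ ∧ ∀ F : Fin m → EuclideanSpace ℝ (Fin n) → ℝ≥0∞, (∀ j, Measurable (F j)) →
      ∫⁻ x, averageMaximal (R / 6) F x ^ harmonicExponent q
          ∂volume.withDensity (productWeight q w) ≤
        C * ∏ j, (∫⁻ x, F j x ^ q j * w j x ∂volume) ^ (harmonicExponent q / q j) := by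
  have hb := h.balancedWeights hm hq
  have hQ := harmonicExponent_pos hm h.pos
  set Q := harmonicExponent q with hQdef
  -- With power `Q/2`, only the `L²(ν)` bound for the maximal function is needed, even when `Q ≤ 1`.
  obtain ⟨C₁, hC₁, hpt⟩ := h.exists_averageMaximal_rpow_le hm hq (half_pos hQ)
  set B : Option (Fin m) → ℝ → ℝ≥0∞ := fun i s =>
    ENNReal.ofReal s * (ENNReal.ofReal (s - 1))⁻¹ *
      (2 ^ s * (K * ENNReal.ofReal (6 ^ n) ^ m) ^ (1 / dualExponent q i)) with hB
  have hBt : ∀ i s, 1 < s → B i s ≠ ∞ := by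
    intro i s hs
    refine ENNReal.mul_ne_top (ENNReal.mul_ne_top (by simp) ?_) (ENNReal.mul_ne_top ?_ ?_)
    · simpa using hs
    · exact ENNReal.rpow_ne_top_of_nonneg (by linarith) (by simp)
    · exact ENNReal.rpow_ne_top_of_nonneg (one_div_nonneg.2 (hb.exponent_pos i).le)
        (ENNReal.mul_ne_top h.ne_top (ENNReal.pow_ne_top (by simp)))
  refine ⟨C₁ ^ (2 : ℝ) * (B none 2 * ∏ j, B (some j) (q j) ^ (Q / q j)), ?_, fun F hF => ?_⟩
  · refine ENNReal.mul_ne_top (ENNReal.rpow_ne_top_of_nonneg (by norm_num) hC₁)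
      (ENNReal.mul_ne_top (hBt _ _ (by norm_num)) (ENNReal.prod_ne_top fun j _ => ?_))
    exact ENNReal.rpow_ne_top_of_nonneg (div_nonneg hQ.le (h.pos j).le) (hBt _ _ (hq j))
  set ν := volume.withDensity (productWeight q w) with hν
  set H := dualMaximalProduct q w (R / 6) F with hH
  have hHm : Measurable H := measurable_dualMaximalProduct h.measurable
  set Mx : Fin m → EuclideanSpace ℝ (Fin n) → ℝ≥0∞ := fun j =>
    measureMaximal (volume.withDensity (dualSystem q w (some j))) (R / 6)
      (fun y => F j y / dualSystem q w (some j) y) with hMx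
  have hMxm : ∀ j, Measurable (Mx j) := fun j => measurable_measureMaximal _ _ _
  have hσm : ∀ i, Measurable (dualSystem q w i) := measurable_dualSystem h.measurable
  have hσ0 := dualSystem_ne_zero (q := q) h.ne_zero
  have hσt := dualSystem_ne_top (q := q) h.ne_zero
  calc ∫⁻ x, averageMaximal (R / 6) F x ^ Q ∂ν
      ≤ ∫⁻ x, C₁ ^ (2 : ℝ) * measureMaximal ν (R / 6) (fun y => H y ^ (Q / 2)) x ^ (2 : ℝ) ∂ν := by
        refine lintegral_mono fun x => ?_
        have h1 := ENNReal.rpow_le_rpow (hpt F hF x) (z := 2) (by norm_num)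
        rwa [← ENNReal.rpow_mul, div_mul_cancel₀ _ (by norm_num),
          ENNReal.mul_rpow_of_nonneg _ _ (by norm_num)] at h1
    _ = C₁ ^ (2 : ℝ) * ∫⁻ x, measureMaximal ν (R / 6) (fun y => H y ^ (Q / 2)) x ^ (2 : ℝ) ∂ν :=
        lintegral_const_mul' _ _ (ENNReal.rpow_ne_top_of_nonneg (by norm_num) hC₁)
    _ ≤ C₁ ^ (2 : ℝ) * (B none 2 * ∫⁻ x, (H x ^ (Q / 2)) ^ (2 : ℝ) ∂ν) := by
        gcongr C₁ ^ (2 : ℝ) * ?_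
        exact lintegral_measureMaximal_rpow_le (hb.locallyDoubling none) (by norm_num)
          (hHm.pow_const _)
    _ = C₁ ^ (2 : ℝ) * (B none 2 * ∫⁻ x, ∏ j, (dualSystem q w (some j) x * Mx j x ^ q j) ^
          (Q / q j) ∂volume) := by
        congr 2
        rw [hν, lintegral_withDensity_eq_lintegral_mul _ (measurable_productWeight h.measurable)
          ((hHm.pow_const _).pow_const _)]
        refine lintegral_congr fun x => ?_
        rw [Pi.mul_apply, ← ENNReal.rpow_mul, div_mul_cancel₀ _ (by norm_num)]
        exact h.dualMaximalProduct_rpow_mul hm hq x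
    _ ≤ C₁ ^ (2 : ℝ) * (B none 2 * ∏ j, (∫⁻ x, dualSystem q w (some j) x * Mx j x ^ q j ∂volume) ^
          (Q / q j)) := by
        gcongr
        exact ENNReal.lintegral_prod_norm_pow_le _
          (fun j _ => ((hσm _).mul ((hMxm j).pow_const _)).aemeasurable)
          (sum_harmonicExponent_div hm h.pos) fun j _ => div_nonneg hQ.le (h.pos j).le
    _ ≤ C₁ ^ (2 : ℝ) * (B none 2 * ∏ j, (B (some j) (q j) *
          ∫⁻ x, F j x ^ q j * w j x ∂volume) ^ (Q / q j)) := by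
        gcongr with j
        · exact div_nonneg hQ.le (h.pos j).le
        have h1 := lintegral_measureMaximal_rpow_le (hb.locallyDoubling (some j)) (hq j)
          ((hF j).div (hσm (some j)))
        rw [lintegral_withDensity_eq_lintegral_mul _ (hσm _) ((measurable_measureMaximal _ _ _).pow_const _),
          lintegral_withDensity_eq_lintegral_mul _ (hσm _) (((hF j).div (hσm (some j))).pow_const _)]
          at h1
        refine h1.trans_eq ?_
        congr 1
        refine lintegral_congr fun x => ?_
        have hj := h.pos j
        have hw0 : (w j x : ℝ≥0∞) ≠ 0 := by simpa using h.ne_zero j x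
        simp only [Pi.mul_apply, Pi.div_apply]
        rw [ENNReal.div_rpow_of_nonneg _ _ hj.le, div_eq_mul_inv, mul_left_comm]
        congr 1
        -- The identity behind the exponents is `σ_j^(1-q_j) = w_j`, since `(1-q_j')(1-q_j) = 1`.
        rw [← ENNReal.rpow_neg]
        conv_lhs => lhs; rw [← ENNReal.rpow_one (dualSystem q w (some j) x)]
        rw [← ENNReal.rpow_add _ _ (hσ0 _ _) (hσt _ _), dualSystem, ← ENNReal.rpow_mul]
        conv_rhs => rw [← ENNReal.rpow_one (w j x : ℝ≥0∞)]
        congr 1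
        have : q j - 1 ≠ 0 := by linarith [hq j]
        rw [Real.conjExponent]
        field_simp
        ring
    _ = _ := by
        rw [mul_assoc (C₁ ^ (2 : ℝ)), mul_assoc (B none 2), ← Finset.prod_mul_distrib]
        congr 2
        refine Finset.prod_congr rfl fun j _ => ?_
        rw [ENNReal.mul_rpow_of_nonneg _ _ (div_nonneg hQ.le (h.pos j).le)]

end StrongType

/-! ### Reduction to positive measurable weights -/

section PositiveWeights

variable {m n : ℕ}

theorem dualFactor_ne_zero {q : ℝ} (hq : 1 ≤ q) {v : EuclideanSpace ℝ (Fin n) → ℝ≥0}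
    (hv : AEMeasurable v volume) (c : EuclideanSpace ℝ (Fin n)) {r : ℝ} (hr : 0 < r) :
    dualFactor q v c r ≠ 0 := by
  have := ae_restrict_ball_neBot c hr
  have hv' : AEMeasurable (fun x => (v x : ℝ≥0∞)) (volume.restrict (ball c r)) :=
    hv.coe_nnreal_ennreal.restrict
  rcases hq.eq_or_lt with rfl | hq
  · simp only [dualFactor, if_true, ENNReal.inv_ne_zero]
    intro ht
    obtain ⟨x, hx⟩ := (ae_essInf_le (μ := volume.restrict (ball c r))
      (f := fun x => (v x : ℝ≥0∞))).exists
    rw [ht] at hx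
    simp at hx
  · simp only [dualFactor, if_neg hq.ne']
    have hc := (Real.HolderConjugate.conjExponent hq).symm.pos
    rw [Ne, ENNReal.rpow_eq_zero_iff_of_pos (by positivity), setLAverage_eq,
      ENNReal.div_eq_zero_iff, not_or]
    refine ⟨fun h0 => ?_, measure_ball_lt_top.ne⟩
    rw [lintegral_eq_zero_iff' (hv'.pow_const _)] at h0
    obtain ⟨x, hx⟩ := h0.exists
    have h1 := (Real.HolderConjugate.conjExponent hq).symm.lt
    simp only [Pi.zero_apply, ENNReal.rpow_eq_zero_iff] at hx
    rcases hx with hx | hx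
    · linarith [hx.2]
    · simp at hx

/-- Zeros of `v` on a set of positive measure make the essential infimum 0, or the negative power
infinite there. -/
theorem dualFactor_eq_top {q : ℝ} (hq : 1 ≤ q) {v : EuclideanSpace ℝ (Fin n) → ℝ≥0}
    (hv : AEMeasurable v volume) {c : EuclideanSpace ℝ (Fin n)} {r : ℝ}
    (h0 : volume ({x | v x = 0} ∩ ball c r) ≠ 0) : dualFactor q v c r = ∞ := by
  have hv' : AEMeasurable (fun x => (v x : ℝ≥0∞)) (volume.restrict (ball c r)) :=
    hv.coe_nnreal_ennreal.restrict
  have h0' : volume.restrict (ball c r) {x | v x = 0} ≠ 0 := by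
    rwa [Measure.restrict_apply' isOpen_ball.measurableSet]
  rcases hq.eq_or_lt with rfl | hq
  · simp only [dualFactor, if_true, ENNReal.inv_eq_top]
    have hf : ∃ᵐ x ∂volume.restrict (ball c r), v x = 0 := frequently_ae_iff.2 h0'
    obtain ⟨x, hx, hx'⟩ := (hf.and_eventually (ae_essInf_le (μ := volume.restrict (ball c r))
      (f := fun x => (v x : ℝ≥0∞)))).exists
    rw [hx] at hx'
    simpa using hx'
  · simp only [dualFactor, if_neg hq.ne']
    have hc := (Real.HolderConjugate.conjExponent hq).symm.pos
    have h1 := (Real.HolderConjugate.conjExponent hq).symm.lt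
    have : ∫⁻ x in ball c r, (v x : ℝ≥0∞) ^ (1 - q.conjExponent) ∂volume = ∞ := by
      refine lintegral_eq_top_of_measure_eq_top_ne_zero (hv'.pow_const _) ?_
      refine fun h2 => h0' (measure_mono_null (fun x hx => ?_) h2)
      have hx' : v x = 0 := hx
      simp only [mem_ofPred_eq, hx', ENNReal.coe_zero]
      exact ENNReal.zero_rpow_of_neg (by linarith)
    rw [setLAverage_eq, this, ENNReal.top_div_of_ne_top measure_ball_lt_top.ne,
      ENNReal.top_rpow_of_pos (by positivity)]

theorem exists_measure_inter_ball_ne_zero {S : Set (EuclideanSpace ℝ (Fin n))}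
    (hS : volume S ≠ 0) : ∃ r : ℝ, ∀ r', r ≤ r' → volume (S ∩ ball 0 r') ≠ 0 := by
  by_contra! h
  refine hS ?_
  have : S ⊆ ⋃ k : ℕ, S ∩ ball 0 k := fun y hy => by
    obtain ⟨k, hk⟩ := exists_nat_gt ‖y‖
    exact mem_iUnion.2 ⟨k, hy, by simpa using hk⟩
  refine measure_mono_null this (measure_iUnion_null fun k => ?_)
  obtain ⟨r', hr', h0⟩ := h k
  exact measure_mono_null (inter_subset_inter_right _ (ball_subset_ball hr')) h0

theorem aemeasurable_productWeight {q : Fin m → ℝ} {w : Fin m → EuclideanSpace ℝ (Fin n) → ℝ≥0}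
    (hw : ∀ j, AEMeasurable (w j) volume) : AEMeasurable (productWeight q w) volume :=
  Finset.aemeasurable_fun_prod _ fun j _ => (hw j).coe_nnreal_ennreal.pow_const _

/-- The components of a multiple weight are positive almost everywhere unless the product weight
vanishes almost everywhere. -/
theorem IsMultipleWeight.ae_ne_zero {q : Fin m → ℝ} {θ : ℝ}
    {w : Fin m → EuclideanSpace ℝ (Fin n) → ℝ≥0} (hw : IsMultipleWeight q θ w) (hm : 1 ≤ m)
    (hq : ∀ j, 1 ≤ q j) (hν : ¬ productWeight q w =ᵐ[volume] 0) (j : Fin m) :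
    ∀ᵐ x, w j x ≠ 0 := by
  classical
  obtain ⟨hwm, C, hC⟩ := hw
  have hQ := harmonicExponent_pos hm fun j => zero_lt_one.trans_le (hq j)
  by_contra hne
  have h1 : volume {x | w j x = 0} ≠ 0 := by simpa [ae_iff] using hne
  have h2 : volume {x | productWeight q w x ≠ 0} ≠ 0 := by
    simpa [Filter.EventuallyEq, ae_iff] using hν
  obtain ⟨r₁, hr₁⟩ := exists_measure_inter_ball_ne_zero h1
  obtain ⟨r₂, hr₂⟩ := exists_measure_inter_ball_ne_zero h2
  -- One ball meets both the zero set of `w j` and the set where `ν` is nonzero in positive measure,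
  -- which makes the left side of the weight condition infinite.
  set r := max 1 (max r₁ r₂) with hr
  have hr0 : 0 < r := zero_lt_one.trans_le (le_max_left _ _)
  have h3 := hr₁ r ((le_max_left _ _).trans (le_max_right _ _))
  have h4 := hr₂ r ((le_max_right _ _).trans (le_max_right _ _))
  have h5 : (⨍⁻ x in ball 0 r, productWeight q w x ∂volume) ^ (1 / harmonicExponent q) ≠ 0 := by
    rw [Ne, ENNReal.rpow_eq_zero_iff_of_pos (by positivity), setLAverage_eq,
      ENNReal.div_eq_zero_iff, not_or]
    refine ⟨fun h0 => h4 ?_, measure_ball_lt_top.ne⟩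
    rw [lintegral_eq_zero_iff' (aemeasurable_productWeight hwm).restrict,
      Filter.EventuallyEq, ae_iff, Measure.restrict_apply' isOpen_ball.measurableSet] at h0
    exact h0
  have h6 := hC 0 r hr0
  rw [← Finset.mul_prod_erase _ _ (Finset.mem_univ j), dualFactor_eq_top (hq j) (hwm j) h3,
    ENNReal.top_mul (Finset.prod_ne_zero_iff.2 fun k _ => dualFactor_ne_zero (hq k) (hwm k) _ hr0),
    ENNReal.mul_top h5] at h6
  exact absurd h6 (not_le.2 (ENNReal.mul_lt_top (by simp) (by simp)))

theorem dualFactor_congr {q : ℝ} {v v' : EuclideanSpace ℝ (Fin n) → ℝ≥0} (h : v =ᵐ[volume] v')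
    (c : EuclideanSpace ℝ (Fin n)) (r : ℝ) : dualFactor q v c r = dualFactor q v' c r := by
  have h' := ae_restrict_of_ae (s := ball c r) h
  unfold dualFactor
  congr 2
  · exact essInf_congr_ae (h'.mono fun x hx => by simp only [hx])
  · exact laverage_congr (h'.mono fun x hx => by simp only [hx])

theorem productWeight_congr {q : Fin m → ℝ} {w w' : Fin m → EuclideanSpace ℝ (Fin n) → ℝ≥0}
    (h : ∀ j, w j =ᵐ[volume] w' j) : productWeight q w =ᵐ[volume] productWeight q w' := by
  filter_upwards [ae_all_iff.2 h] with x hx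
  simp only [productWeight, hx]

/-- The condition depends only on almost everywhere classes, so measurable representatives are taken
and their zeros, a null set, are replaced by 1. As `θ ≥ 0`, the growth factor is at most its value
at `R`. -/
theorem IsMultipleWeightInfty.exists_isLocalWeight {q : Fin m → ℝ}
    {w : Fin m → EuclideanSpace ℝ (Fin n) → ℝ≥0} (hw : IsMultipleWeightInfty q w) (hm : 1 ≤ m)
    (hq : ∀ j, 1 ≤ q j) (hν : ¬ productWeight q w =ᵐ[volume] 0) (R : ℝ) :
    ∃ w' K, (∀ j, w j =ᵐ[volume] w' j) ∧ IsLocalWeight q w' R K := by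
  obtain ⟨θ, hθ, hw⟩ := hw
  have hpos := hw.ae_ne_zero hm hq hν
  obtain ⟨hwm, C, hC⟩ := hw
  set w' : Fin m → EuclideanSpace ℝ (Fin n) → ℝ≥0 :=
    fun j x => if (hwm j).mk (w j) x = 0 then 1 else (hwm j).mk (w j) x with hw'
  have hae : ∀ j, w j =ᵐ[volume] w' j := fun j => by
    filter_upwards [hpos j, (hwm j).ae_eq_mk] with x h1 h2
    simp only [hw']
    rw [if_neg (by rwa [← h2]), ← h2]
  refine ⟨w', C * ENNReal.ofReal ((1 + R) ^ θ), hae, ⟨fun j => ?_, fun j x => ?_, hq,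
    ENNReal.mul_ne_top (by simp) (by simp), fun c r hr hrR => ?_⟩⟩
  · exact Measurable.ite ((hwm j).measurable_mk (measurableSet_singleton 0)) measurable_const
      (hwm j).measurable_mk
  · simp only [hw']
    split_ifs with h
    · exact one_ne_zero
    · exact h
  · have h1 := hC c r hr
    rw [laverage_congr (ae_restrict_of_ae (productWeight_congr hae)),
      Finset.prod_congr rfl fun j _ => dualFactor_congr (hae j) c r] at h1
    refine h1.trans ?_
    gcongr

end PositiveWeights

/-! ### Bounds for general weights and almost everywhere measurable functions -/

section AEMeasurable

variable {m n : ℕ}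

theorem averageMaximal_congr {F F' : Fin m → EuclideanSpace ℝ (Fin n) → ℝ≥0∞}
    (h : ∀ j, F j =ᵐ[volume] F' j) (R : ℝ) : averageMaximal R F = averageMaximal R F' := by
  unfold averageMaximal
  congr 1
  funext c r
  exact Finset.prod_congr rfl fun j _ => laverage_congr (ae_restrict_of_ae (h j))

variable {q : Fin m → ℝ} {w : Fin m → EuclideanSpace ℝ (Fin n) → ℝ≥0}

theorem IsMultipleWeightInfty.exists_lintegral_averageMaximal_le
    (hw : IsMultipleWeightInfty q w) (hm : 1 ≤ m) (hq : ∀ j, 1 < q j) (R : ℝ) :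
    ∃ C : ℝ≥0∞, C ≠ ∞ ∧ ∀ F : Fin m → EuclideanSpace ℝ (Fin n) → ℝ≥0∞,
      (∀ j, AEMeasurable (F j) volume) →
      ∫⁻ x, averageMaximal R F x ^ harmonicExponent q ∂volume.withDensity (productWeight q w) ≤
        C * ∏ j, (∫⁻ x, F j x ^ q j * w j x ∂volume) ^ (harmonicExponent q / q j) := by
  by_cases hν : productWeight q w =ᵐ[volume] 0
  · exact ⟨0, by simp, fun F _ => by simp [withDensity_congr_ae hν]⟩
  -- The radius `6 * R` compensates for the factor 6 lost to doubling.
  obtain ⟨w', K, hae, hl⟩ := hw.exists_isLocalWeight hm (fun j => (hq j).le) hν (6 * R)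
  obtain ⟨C, hC, h⟩ := hl.exists_lintegral_averageMaximal_rpow_le hm hq
  refine ⟨C, hC, fun F hF => ?_⟩
  have h1 := h (fun j => (hF j).mk) fun j => (hF j).measurable_mk
  rw [mul_div_cancel_left₀ R (by norm_num),
    ← averageMaximal_congr (fun j => (hF j).ae_eq_mk) R,
    ← withDensity_congr_ae (productWeight_congr hae)] at h1
  refine h1.trans_eq ?_
  congr 1
  refine Finset.prod_congr rfl fun j _ => ?_
  congr 1
  refine lintegral_congr_ae ?_
  filter_upwards [(hF j).ae_eq_mk, hae j] with x h2 h3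
  rw [← h2, h3]

theorem IsMultipleWeightInfty.exists_measure_lt_averageMaximal_le
    (hw : IsMultipleWeightInfty q w) (hm : 1 ≤ m) (hq : ∀ j, 1 ≤ q j) (R : ℝ) :
    ∃ C : ℝ≥0∞, C ≠ ∞ ∧ ∀ F : Fin m → EuclideanSpace ℝ (Fin n) → ℝ≥0∞,
      (∀ j, AEMeasurable (F j) volume) → ∀ b : ℝ≥0∞,
      b ^ harmonicExponent q *
          volume.withDensity (productWeight q w) {x | b < averageMaximal R F x} ≤
        C * ∏ j, (∫⁻ x, F j x ^ q j * w j x ∂volume) ^ (harmonicExponent q / q j) := by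
  by_cases hν : productWeight q w =ᵐ[volume] 0
  · exact ⟨0, by simp, fun F _ b => by simp [withDensity_congr_ae hν]⟩
  obtain ⟨w', K, hae, hl⟩ := hw.exists_isLocalWeight hm hq hν (6 * R)
  have hQ := harmonicExponent_pos hm hl.pos
  refine ⟨(K * ENNReal.ofReal (6 ^ n) ^ m) ^ harmonicExponent q * K ^ harmonicExponent q,
    ENNReal.mul_ne_top
      (ENNReal.rpow_ne_top_of_nonneg hQ.le
        (ENNReal.mul_ne_top hl.ne_top (ENNReal.pow_ne_top (by simp))))
      (ENNReal.rpow_ne_top_of_nonneg hQ.le hl.ne_top), fun F hF b => ?_⟩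
  have h1 := hl.rpow_mul_measure_lt_averageMaximal_le hm (fun j => (hF j).measurable_mk) b
  rw [mul_div_cancel_left₀ R (by norm_num),
    ← averageMaximal_congr (fun j => (hF j).ae_eq_mk) R,
    ← withDensity_congr_ae (productWeight_congr hae)] at h1
  refine h1.trans_eq ?_
  congr 1
  refine Finset.prod_congr rfl fun j _ => ?_
  congr 1
  refine lintegral_congr_ae ?_
  filter_upwards [(hF j).ae_eq_mk, hae j] with x h2 h3
  rw [← h2, h3]

end AEMeasurable

/-! ### From the localized maximal function to small balls -/

section Localized

variable {m n : ℕ}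

theorem multilinearMaximal_indicator_le {s : ℝ} (hs : 0 < s)
    (f : Fin m → EuclideanSpace ℝ (Fin n) → ℂ) {a y : EuclideanSpace ℝ (Fin n)}
    (hy : y ∈ ball a 1) :
    multilinearMaximal s (fun j => (ball a 8).indicator (f j)) y ≤
      averageMaximal 8 (fun j z => ‖f j z‖ₑ ^ s) y ^ (1 / s) := by
  have hind : ∀ j z, ‖(ball a 8).indicator (f j) z‖ₑ ^ s =
      (ball a 8).indicator (fun z => ‖f j z‖ₑ ^ s) z := fun j z => by
    by_cases hz : z ∈ ball a 8
    · simp [indicator_of_mem hz]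
    · simp [indicator_of_notMem hz, hs]
  refine iSup_le fun c => iSup_le fun r => iSup_le fun hr => iSup_le fun hyc => ?_
  rw [ENNReal.prod_rpow_of_nonneg (by positivity)]
  refine ENNReal.rpow_le_rpow ?_ (by positivity)
  simp only [hind]
  rcases le_total r 8 with h8 | h8
  · refine le_trans (Finset.prod_le_prod' fun j _ => ?_) (le_ballSup hr h8 hyc)
    simp only [setLAverage_eq]
    gcongr with z
    exact indicator_le_self _ _ _
  -- A ball of radius at least 8 has no smaller volume than `ball a 8`, which carries the whole
  -- integral of the cut-off function.
  · refine le_trans (Finset.prod_le_prod' fun j _ => ?_)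
      (le_ballSup (c := a) (by norm_num) le_rfl (ball_subset_ball (by norm_num) hy))
    simp only [setLAverage_eq]
    refine ENNReal.div_le_div ?_ ?_
    · refine (setLIntegral_le_lintegral _ _).trans_eq ?_
      exact lintegral_indicator isOpen_ball.measurableSet _
    · rw [Measure.addHaar_ball_center volume a, ← Measure.addHaar_ball_center volume c]
      exact measure_mono (ball_subset_ball h8)

theorem IsCriticalCovering.exists_localizedMaximal_le
    {x : ℕ → EuclideanSpace ℝ (Fin n)} (hx : IsCriticalCovering x) {s : ℝ} (hs : 0 < s) :
    ∃ A : ℝ≥0, A ≠ 0 ∧ ∀ (f : Fin m → EuclideanSpace ℝ (Fin n) → ℂ) (y),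
      localizedMaximal s x f y ≤
        A * averageMaximal 8 (fun j z => ‖f j z‖ₑ ^ s) y ^ (1 / s) := by
  obtain ⟨-, C, hC⟩ := hx
  -- The overlap bound is available only for `σ > 1`, so it is used at `σ = 2`. Adding 1 makes the
  -- constant nonzero, since the weak type bound divides by it.
  refine ⟨C * Real.toNNReal (2 ^ n) + 1, by positivity, fun f y => ?_⟩
  set G := averageMaximal 8 (fun j z => ‖f j z‖ₑ ^ s) y ^ (1 / s)
  calc localizedMaximal s x f y
      ≤ ∑' k, (ball (x k) 2).indicator (fun _ => (1 : ℝ≥0∞)) y * G := by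
        refine ENNReal.tsum_le_tsum fun k => ?_
        by_cases hy : y ∈ ball (x k) 1
        · rw [indicator_of_mem hy,
            indicator_of_mem (ball_subset_ball (by norm_num) hy), one_mul]
          exact multilinearMaximal_indicator_le hs f hy
        · simp [indicator_of_notMem hy]
    _ = (∑' k, (ball (x k) 2).indicator (fun _ => (1 : ℝ≥0∞)) y) * G := ENNReal.tsum_mul_right
    _ ≤ C * ENNReal.ofReal (2 ^ n) * G := by gcongr; exact hC 2 (by norm_num) y
    _ ≤ _ := by
        push_cast
        gcongr
        exact le_self_add

theorem harmonicExponent_div (p : Fin m → ℝ) (s : ℝ) :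
    harmonicExponent (fun j => p j / s) = harmonicExponent p / s := by
  simp only [harmonicExponent, inv_div, div_eq_mul_inv s, ← Finset.mul_sum, mul_inv]
  rw [mul_comm, div_eq_mul_inv]

theorem productWeight_div (p : Fin m → ℝ) {s : ℝ} (hs : s ≠ 0)
    (w : Fin m → EuclideanSpace ℝ (Fin n) → ℝ≥0) :
    productWeight (fun j => p j / s) w = productWeight p w := by
  funext x
  simp only [productWeight, harmonicExponent_div, div_div_div_cancel_right₀ hs]

theorem eLpNorm_withDensity_eq {p : ℝ} (hp : 0 < p) {v : EuclideanSpace ℝ (Fin n) → ℝ≥0}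
    (hv : AEMeasurable v volume) {f : EuclideanSpace ℝ (Fin n) → ℂ}
    (hf : AEStronglyMeasurable f volume) :
    eLpNorm f (ENNReal.ofReal p) (volume.withDensity fun y => (v y : ℝ≥0∞)) =
      (∫⁻ x, ‖f x‖ₑ ^ p * v x ∂volume) ^ (1 / p) := by
  rw [eLpNorm_eq_lintegral_rpow_enorm_toReal (by simpa using hp) (by simp),
    ENNReal.toReal_ofReal hp.le,
    lintegral_withDensity_eq_lintegral_mul₀ hv.coe_nnreal_ennreal (hf.enorm.pow_const _)]
  congr 1
  exact lintegral_congr fun x => mul_comm _ _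

theorem prod_lintegral_rpow_eq {p : Fin m → ℝ} {s : ℝ} (hs : 0 < s) (hp : ∀ j, 0 < p j)
    (hm : 1 ≤ m) {w : Fin m → EuclideanSpace ℝ (Fin n) → ℝ≥0}
    (hw : ∀ j, AEMeasurable (w j) volume) {f : Fin m → EuclideanSpace ℝ (Fin n) → ℂ}
    (hf : ∀ j, AEStronglyMeasurable (f j) volume) :
    (∏ j, (∫⁻ x, (‖f j x‖ₑ ^ s) ^ (p j / s) * w j x ∂volume) ^
        (harmonicExponent p / s / (p j / s))) ^ (1 / harmonicExponent p) =
      ∏ j, eLpNorm (f j) (ENNReal.ofReal (p j))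
        (volume.withDensity fun y => (w j y : ℝ≥0∞)) := by
  have hQ := harmonicExponent_pos hm hp
  rw [← ENNReal.prod_rpow_of_nonneg (by positivity)]
  refine Finset.prod_congr rfl fun j _ => ?_
  rw [eLpNorm_withDensity_eq (hp j) (hw j) (hf j), ← ENNReal.rpow_mul]
  have hj := hp j
  congr 1
  · refine lintegral_congr fun x => ?_
    rw [← ENNReal.rpow_mul, mul_div_cancel₀ _ hs.ne']
  · field_simp

end Localized

/-! ### The main theorem -/

theorem proposition2p8 {m n : ℕ} (hm : 1 ≤ m) (hn : 1 ≤ n)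
    (x : ℕ → EuclideanSpace ℝ (Fin n)) (hx : IsCriticalCovering x)
    (s : ℝ) (hs : 0 < s) (p : Fin m → ℝ)
    (w : Fin m → EuclideanSpace ℝ (Fin n) → ℝ≥0)
    (hw : IsMultipleWeightInfty (fun j => p j / s) w) :
    ((∀ j, s < p j) →
      ∃ C : ℝ≥0, ∀ f : Fin m → EuclideanSpace ℝ (Fin n) → ℂ,
        (∀ j, AEStronglyMeasurable (f j) volume) →
        eLpNorm (localizedMaximal s x f) (ENNReal.ofReal (harmonicExponent p))
            (volume.withDensity (productWeight p w))
          ≤ C * ∏ j, eLpNorm (f j) (ENNReal.ofReal (p j))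
              (volume.withDensity (fun y => (w j y : ℝ≥0∞)))) ∧
    ((∀ j, s ≤ p j) →
      ∃ C : ℝ≥0, ∀ f : Fin m → EuclideanSpace ℝ (Fin n) → ℂ,
        (∀ j, AEStronglyMeasurable (f j) volume) →
        weakLpNorm (localizedMaximal s x f) (harmonicExponent p)
            (volume.withDensity (productWeight p w))
          ≤ C * ∏ j, eLpNorm (f j) (ENNReal.ofReal (p j))
              (volume.withDensity (fun y => (w j y : ℝ≥0∞)))) := by
  obtain ⟨A, hA0, hA⟩ := hx.exists_localizedMaximal_le (m := m) hs
  have hwm : ∀ j, AEMeasurable (w j) volume := by obtain ⟨θ, -, h, -⟩ := hw; exact h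
  refine ⟨fun hp => ?_, fun hp => ?_⟩
  · have hp0 : ∀ j, 0 < p j := fun j => hs.trans (hp j)
    have hQ := harmonicExponent_pos hm hp0
    obtain ⟨C, hC, h⟩ := hw.exists_lintegral_averageMaximal_le hm
      (fun j => (one_lt_div hs).2 (hp j)) 8
    have hCt : C ^ (1 / harmonicExponent p) ≠ ∞ :=
      ENNReal.rpow_ne_top_of_nonneg (by positivity) hC
    refine ⟨A * (C ^ (1 / harmonicExponent p)).toNNReal, fun f hf => ?_⟩
    have h1 := h (fun j z => ‖f j z‖ₑ ^ s) fun j => (hf j).enorm.pow_const _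
    simp only [harmonicExponent_div, productWeight_div p hs.ne'] at h1
    rw [ENNReal.coe_mul, ENNReal.coe_toNNReal hCt,
      eLpNorm_eq_lintegral_rpow_enorm_toReal (by simpa using hQ) (by simp),
      ENNReal.toReal_ofReal hQ.le, ← prod_lintegral_rpow_eq hs hp0 hm hwm hf]
    set Q := harmonicExponent p
    simp only [enorm_eq_self]
    calc (∫⁻ y, localizedMaximal s x f y ^ Q ∂volume.withDensity (productWeight p w)) ^ (1 / Q)
        ≤ (∫⁻ y, (A : ℝ≥0∞) ^ Q * averageMaximal 8 (fun j z => ‖f j z‖ₑ ^ s) y ^ (Q / s)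
            ∂volume.withDensity (productWeight p w)) ^ (1 / Q) := by
          gcongr with y
          have h2 := ENNReal.rpow_le_rpow (hA f y) hQ.le
          rwa [ENNReal.mul_rpow_of_nonneg _ _ hQ.le, ← ENNReal.rpow_mul,
            one_div_mul_eq_div] at h2
      _ ≤ ((A : ℝ≥0∞) ^ Q * (C * _)) ^ (1 / Q) := by
          rw [lintegral_const_mul' _ _ (ENNReal.rpow_ne_top_of_nonneg hQ.le (by simp))]
          gcongr
      _ = _ := by
          rw [ENNReal.mul_rpow_of_nonneg _ _ (by positivity),
            ENNReal.mul_rpow_of_nonneg _ _ (by positivity), ← ENNReal.rpow_mul,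
            mul_one_div_cancel hQ.ne', ENNReal.rpow_one, mul_assoc]
  · have hp0 : ∀ j, 0 < p j := fun j => hs.trans_le (hp j)
    have hQ := harmonicExponent_pos hm hp0
    obtain ⟨C, hC, h⟩ := hw.exists_measure_lt_averageMaximal_le hm
      (fun j => (one_le_div hs).2 (hp j)) 8
    have hCt : C ^ (1 / harmonicExponent p) ≠ ∞ :=
      ENNReal.rpow_ne_top_of_nonneg (by positivity) hC
    refine ⟨A * (C ^ (1 / harmonicExponent p)).toNNReal, fun f hf => iSup_le fun t => ?_⟩
    -- Height `t` for the localized function corresponds to height `(t/A)^s` for the averages of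
    -- `|f_j|^s`.
    have h1 := h (fun j z => ‖f j z‖ₑ ^ s) (fun j => (hf j).enorm.pow_const _)
      (((t / A : ℝ≥0) : ℝ≥0∞) ^ s)
    simp only [harmonicExponent_div, productWeight_div p hs.ne'] at h1
    rw [ENNReal.coe_mul, ENNReal.coe_toNNReal hCt, ← prod_lintegral_rpow_eq hs hp0 hm hwm hf]
    set Q := harmonicExponent p
    set ν := volume.withDensity (productWeight p w)
    have hsub : {y | (t : ℝ≥0∞) < localizedMaximal s x f y} ⊆
        {y | ((t / A : ℝ≥0) : ℝ≥0∞) ^ s < averageMaximal 8 (fun j z => ‖f j z‖ₑ ^ s) y} := by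
      intro y hy
      have h2 : (t : ℝ≥0∞) < _ := lt_of_lt_of_le hy (hA f y)
      have h3 : ((t / A : ℝ≥0) : ℝ≥0∞) <
          averageMaximal 8 (fun j z => ‖f j z‖ₑ ^ s) y ^ (1 / s) := by
        rw [ENNReal.coe_div hA0]
        exact ENNReal.div_lt_of_lt_mul' h2
      rw [one_div] at h3
      exact (ENNReal.lt_rpow_inv_iff hs).1 h3
    have htA : (t : ℝ≥0∞) = A * ((t / A : ℝ≥0) : ℝ≥0∞) := by
      rw [← ENNReal.coe_mul, mul_div_cancel₀ _ hA0]
    rw [← ENNReal.rpow_mul, mul_div_cancel₀ _ hs.ne'] at h1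
    have h4 := ENNReal.rpow_le_rpow h1 (z := 1 / Q) (by positivity)
    rw [ENNReal.mul_rpow_of_nonneg _ _ (by positivity),
      ENNReal.mul_rpow_of_nonneg _ _ (by positivity), ← ENNReal.rpow_mul,
      mul_one_div_cancel hQ.ne', ENNReal.rpow_one] at h4
    calc (t : ℝ≥0∞) * ν {y | (t : ℝ≥0∞) < localizedMaximal s x f y} ^ (1 / Q)
        ≤ A * (((t / A : ℝ≥0) : ℝ≥0∞) * ν {y | ((t / A : ℝ≥0) : ℝ≥0∞) ^ s <
            averageMaximal 8 (fun j z => ‖f j z‖ₑ ^ s) y} ^ (1 / Q)) := by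
          rw [htA, ← mul_assoc, ← htA]
          gcongr
      _ ≤ _ := by
          rw [mul_assoc]
          gcongr
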